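/- **Setting.** For a Borel probability measure $\nu$ on a metric space let $$\tau_\nu(q)=\lim_{\delta\to0^+}\frac{\log\int_{\operatorname{supp}\nu}\nu(B(x,\delta))^{q-1}\,d\nu(x)}{-\log\delta}$$ be its $L^q$-spectrum, when the limit exists. Consider finitely many maps $S_i(x,y)=(\pm c_i x,\pm d_i y)+t_i$ of $\mathbb R^2$ with $c_i,d_i\in(0,1)$, $i\in\mathcal I$, and a probability vector $(p_i)$ with $p_i\in(0,1)$, and let $\mu$ be the associated self-affine measure, i.e. the Borel probability measure with $\mu=\sum_i p_i\,\mu\circ S_i^{-1}$. Let $\tau_1(q),\tau_2(q)$ be the $L^q$-spectra of the projections $\pi_1\mu,\pi_2\mu$ of $\mu$ to the coordinate axes. For $\boldsymbol i=(i_1,\dots,i_k)\in\mathcal I^k$ put $p(\boldsymbol i)=\prod_j p_{i_j}$, $c(\boldsymbol i)=\prod_j c_{i_j}$, $d(\boldsymbol i)=\prod_j d_{i_j}$, $\alpha_1(\boldsymbol i)=\max\{c(\boldsymbol i),d(\boldsymbol i)\}$, $\alpha_2(\boldsymbol i)=\min\{c(\boldsymbol i),d(\boldsymbol i)\}$, and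 $\tau_{\boldsymbol i}(q)=\tau_1(q)$ if $c(\boldsymbol i)\ge d(\boldsymbol i)$, $\tau_{\boldsymbol i}(q)=\tau_2(q)$ otherwise. Let $$P(t,q)=\lim_{k\to\infty}\Big(\sum_{\boldsymbol i\in\mathcal I^k}p(\boldsymbol i)^q\,\alpha_1(\boldsymbol i)^{\tau_{\boldsymbol i}(q)}\,\alpha_2(\boldsymbol i)^{t-\tau_{\boldsymbol i}(q)}\Big)^{1/k},$$ and define $\gamma(q),\gamma_A(q),\gamma_B(q)\in\mathbb R$ by $$P(\gamma(q),q)=1,\qquad \sum_i p_i^q c_i^{\tau_1(q)}d_i^{\gamma_A(q)-\tau_1(q)}=1,\qquad \sum_i p_i^q d_i^{\tau_2(q)}c_i^{\gamma_B(q)-\tau_2(q)}=1.$$ **Theorem.** Let $c>d>0$ with $c+d\le1$, and let $\mu$ be the self-affine measure of the two maps $$S_1(x,y)=(cx,\,dy),\qquad S_2(x,y)=(dx,\,cy)+(1-d,\,1-c)$$ with weights $(1/2,1/2)$. Then for every $q>1$ the limits defining $\tau_1(q)$, $\tau_2(q)$ and $P(t,q)$, $t\in\mathbb R$, exist, the numbers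 $\gamma(q),\gamma_A(q),\gamma_B(q)$ are uniquely determined by their defining equations, and $$\gamma(q)<\min\{\gamma_A(q),\gamma_B(q)\}.$$ More precisely, $\gamma_A(q)=\gamma_B(q)<0$ and, writing $s$ for this common value, $$\gamma(q)\le s-\frac{2\log\left(\frac{2(d/c)^{s/2}}{(d/c)^s+1}\right)}{\log(cd)}.$$ Moreover $\min\{\gamma_A(q),\gamma_B(q)\}\ge\tau_1(q)+\tau_2(q)$ and $$\sum_i p_i^q c_i^{\tau_1(q)}d_i^{\gamma_A(q)-\tau_1(q)}\log(c_i/d_i)<0,\qquad \sum_i p_i^q d_i^{\tau_2(q)}c_i^{\gamma_B(q)-\tau_2(q)}\log(d_i/c_i)<0,$$ so that Fraser's question, whether $\gamma(q)=\min\{\gamma_A(q),\gamma_B(q)\}$ always holds under these three inequalities, has a negative answer. -/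

import Mathlib

open MeasureTheory Filter Topology
open scoped ENNReal

noncomputable section

/-- The upper `L^q`-spectrum of a Borel measure `ν`, as an extended real number. -/
def upperLqSpectrum {X : Type*} [PseudoMetricSpace X] [MeasurableSpace X]
    (ν : Measure X) (q : ℝ) : EReal :=
  limsup (fun δ : ℝ =>
    ENNReal.log (∫⁻ x in ν.support, ν (Metric.closedBall x δ) ^ (q - 1) ∂ν) /
      ((-Real.log δ : ℝ) : EReal)) (𝓝[>] 0)

/-- The lower `L^q`-spectrum of a Borel measure `ν`, as an extended real number. -/
def lowerLqSpectrum {X : Type*} [PseudoMetricSpace X] [MeasurableSpace X]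
    (ν : Measure X) (q : ℝ) : EReal :=
  liminf (fun δ : ℝ =>
    ENNReal.log (∫⁻ x in ν.support, ν (Metric.closedBall x δ) ^ (q - 1) ∂ν) /
      ((-Real.log δ : ℝ) : EReal)) (𝓝[>] 0)

/-- The `L^q`-spectrum of `ν` exists at `q` and equals the real number `t`. -/
def HasLqSpectrum {X : Type*} [PseudoMetricSpace X] [MeasurableSpace X]
    (ν : Measure X) (q t : ℝ) : Prop :=
  upperLqSpectrum ν q = (t : EReal) ∧ lowerLqSpectrum ν q = (t : EReal)

/-- The `L^q`-spectrum of `ν` at `q`; to be used when it exists as a real number, that is when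
`HasLqSpectrum ν q (lqSpectrum ν q)` holds. -/
def lqSpectrum {X : Type*} [PseudoMetricSpace X] [MeasurableSpace X]
    (ν : Measure X) (q : ℝ) : ℝ :=
  (upperLqSpectrum ν q).toReal

/-- A planar diagonal system together with a probability vector: finitely many maps
`S i (x, y) = (a i * x, b i * y) + t i` with `0 < |a i|, |b i| < 1`, and weights `p i ∈ (0, 1)`
that add up to one. -/
structure DiagonalSystem (ι : Type*) [Fintype ι] where
  /-- first diagonal entry, with its sign -/
  a : ι → ℝ
  /-- second diagonal entry, with its sign -/
  b : ι → ℝ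
  /-- translation vector -/
  t : ι → ℝ × ℝ
  /-- probability vector -/
  p : ι → ℝ
  abs_a_pos : ∀ i, 0 < |a i|
  abs_a_lt_one : ∀ i, |a i| < 1
  abs_b_pos : ∀ i, 0 < |b i|
  abs_b_lt_one : ∀ i, |b i| < 1
  p_pos : ∀ i, 0 < p i
  p_lt_one : ∀ i, p i < 1
  sum_p : ∑ i, p i = 1

namespace DiagonalSystem

variable {ι : Type*} [Fintype ι]

/-- The affine contraction with index `i`. -/
def S (D : DiagonalSystem ι) (i : ι) (z : ℝ × ℝ) : ℝ × ℝ :=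
  (D.a i * z.1 + (D.t i).1, D.b i * z.2 + (D.t i).2)

/-- The contraction ratio of `S i` in the first coordinate. -/
def c (D : DiagonalSystem ι) (i : ι) : ℝ := |D.a i|

/-- The contraction ratio of `S i` in the second coordinate. -/
def d (D : DiagonalSystem ι) (i : ι) : ℝ := |D.b i|

/-- `μ` is the self-affine measure of the system: the Borel probability measure on the plane with
`μ = ∑ i, p i • μ ∘ (S i)⁻¹`. -/
def IsSelfAffineMeasure (D : DiagonalSystem ι) (μ : Measure (ℝ × ℝ)) : Prop :=
  IsProbabilityMeasure μ ∧ μ = ∑ i, ENNReal.ofReal (D.p i) • μ.map (D.S i)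

/-- `p(𝐢) = p (i₁) ⋯ p (i_k)` for a word of length `k`. -/
def pWord (D : DiagonalSystem ι) {k : ℕ} (w : Fin k → ι) : ℝ := ∏ j, D.p (w j)

/-- `c(𝐢) = c (i₁) ⋯ c (i_k)`. -/
def cWord (D : DiagonalSystem ι) {k : ℕ} (w : Fin k → ι) : ℝ := ∏ j, D.c (w j)

/-- `d(𝐢) = d (i₁) ⋯ d (i_k)`. -/
def dWord (D : DiagonalSystem ι) {k : ℕ} (w : Fin k → ι) : ℝ := ∏ j, D.d (w j)

/-- The larger singular value of the (diagonal) linear part of `S_𝐢`. -/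
def alpha1 (D : DiagonalSystem ι) {k : ℕ} (w : Fin k → ι) : ℝ := max (D.cWord w) (D.dWord w)

/-- The smaller singular value of the (diagonal) linear part of `S_𝐢`. -/
def alpha2 (D : DiagonalSystem ι) {k : ℕ} (w : Fin k → ι) : ℝ := min (D.cWord w) (D.dWord w)

/-- `τ_𝐢(q)`: the `L^q`-spectrum of the projection of `μ` to the coordinate axis along which the
image of the unit square under `S_𝐢` is longest. -/
def tauWord (D : DiagonalSystem ι) (μ : Measure (ℝ × ℝ)) (q : ℝ) {k : ℕ} (w : Fin k → ι) : ℝ :=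
  if D.dWord w ≤ D.cWord w then lqSpectrum (μ.map Prod.fst) q
  else lqSpectrum (μ.map Prod.snd) q

/-- The `q`-modified singular value function `ψ^{s,q}(𝐢)`. -/
def psi (D : DiagonalSystem ι) (μ : Measure (ℝ × ℝ)) (s q : ℝ) {k : ℕ} (w : Fin k → ι) : ℝ :=
  D.pWord w ^ q * D.alpha1 w ^ D.tauWord μ q w * D.alpha2 w ^ (s - D.tauWord μ q w)

/-- `Ψ_k^{s,q}`, the sum of `ψ^{s,q}` over all words of length `k`. -/
def Psi (D : DiagonalSystem ι) (μ : Measure (ℝ × ℝ)) (s q : ℝ) (k : ℕ) : ℝ :=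
  ∑ w : Fin k → ι, D.psi μ s q w

/-- The limit `P(s, q) = lim_{k → ∞} (Ψ_k^{s,q})^{1/k}` exists and equals `P`. -/
def HasPressure (D : DiagonalSystem ι) (μ : Measure (ℝ × ℝ)) (s q P : ℝ) : Prop :=
  Tendsto (fun k : ℕ => D.Psi μ s q k ^ (1 / (k : ℝ))) atTop (𝓝 P)

/-- The defining equation `P(g, q) = 1` of the value `g = γ(q)` of the moment scaling function. -/
def IsGamma (D : DiagonalSystem ι) (μ : Measure (ℝ × ℝ)) (q g : ℝ) : Prop :=
  D.HasPressure μ g q 1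

/-- The defining equation `∑ p_i^q c_i^{τ₁(q)} d_i^{g - τ₁(q)} = 1` of the value `g = γ_A(q)`. -/
def IsGammaA (D : DiagonalSystem ι) (μ : Measure (ℝ × ℝ)) (q g : ℝ) : Prop :=
  ∑ i, D.p i ^ q * D.c i ^ lqSpectrum (μ.map Prod.fst) q *
    D.d i ^ (g - lqSpectrum (μ.map Prod.fst) q) = 1

/-- The defining equation `∑ p_i^q d_i^{τ₂(q)} c_i^{g - τ₂(q)} = 1` of the value `g = γ_B(q)`. -/
def IsGammaB (D : DiagonalSystem ι) (μ : Measure (ℝ × ℝ)) (q g : ℝ) : Prop :=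
  ∑ i, D.p i ^ q * D.d i ^ lqSpectrum (μ.map Prod.snd) q *
    D.c i ^ (g - lqSpectrum (μ.map Prod.snd) q) = 1

end DiagonalSystem

/-- The system of the two maps `S₁ = diag(c, d)` and `S₂ = diag(d, c) + (1 - d, 1 - c)` with
weights `(1/2, 1/2)`. -/
def twoMapSystem (c d : ℝ) (hd : 0 < d) (hdc : d < c) (hcd : c + d ≤ 1) :
    DiagonalSystem (Fin 2) where
  a := ![c, d]
  b := ![d, c]
  t := ![(0, 0), (1 - d, 1 - c)]
  p := fun _ => 1 / 2
  abs_a_pos := by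
    intro i
    fin_cases i
    · exact abs_pos.2 (hd.trans hdc).ne'
    · exact abs_pos.2 hd.ne'
  abs_a_lt_one := by
    intro i
    fin_cases i
    · exact abs_lt.2 ⟨show (-1 : ℝ) < c by linarith, show c < 1 by linarith⟩
    · exact abs_lt.2 ⟨show (-1 : ℝ) < d by linarith, show d < 1 by linarith⟩
  abs_b_pos := by
    intro i
    fin_cases i
    · exact abs_pos.2 hd.ne'
    · exact abs_pos.2 (hd.trans hdc).ne'
  abs_b_lt_one := by
    intro i
    fin_cases i
    · exact abs_lt.2 ⟨show (-1 : ℝ) < d by linarith, show d < 1 by linarith⟩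
    · exact abs_lt.2 ⟨show (-1 : ℝ) < c by linarith, show c < 1 by linarith⟩
  p_pos := by intro _; norm_num
  p_lt_one := by intro _; norm_num
  sum_p := by norm_num

end

/-!
Both projections of `μ` are self-similar measures on `[0, 1]` for two maps whose images overlap at
most in an end point; their ratios are `c, d` for one projection and `d, c` for the other. For
`q > 1` both therefore have the `L^q`-spectrum `τ < 0` given by `2 ^ (-q) (c ^ τ + d ^ τ) = 1`
(`IsTwoMapMeasure.hasLqSpectrum`). The proof compares `I(δ) = ∫ ν (B (x, δ)) ^ (q - 1) dν(x)` with
`2 ^ (-q) (I(δ / c) + I(δ / d))`: the former is never smaller, and it is larger by at most a factor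
close to one and an error `O(δ ^ (-τ))`, which comes from balls that meet both images. That error is
controlled by the mass of the ends of the support (`IsTwoMapMeasure.measureReal_ends_le`), and an
induction over scales turns the two recursions into power bounds.

As `τ₁ = τ₂ = τ`, the equations of `γ_A` and `γ_B` coincide and are solved by `τ` itself, so
`γ_A = γ_B = τ`. The pressure depends on a word only through the side lengths `C` and `D` of the
image rectangle, whose product is `(c d) ^ k`. If `t ≤ 2 τ`, a summand is the larger of
`C ^ τ D ^ (t - τ)` and `D ^ τ C ^ (t - τ)`, and the multinomial formula gives
`P(t) = 2 ^ (-q) (c ^ τ d ^ (t - τ) + d ^ τ c ^ (t - τ))`, which exceeds `1`. If `t ≥ 2 τ`, a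
summand is the smaller of the two, which is largest for balanced words; there are about `2 ^ k` of
these, up to a factor `k + 1`, so `P(t) = 2 ^ (1 - q) (c d) ^ (t / 2)`. Hence
`(c d) ^ (γ / 2) = 2 ^ (q - 1) = (c ^ τ + d ^ τ) / 2`. The inequality of arithmetic and geometric
means makes this larger than `(c d) ^ (τ / 2)`, that is, `γ < τ`; taking logarithms shows that the
quantitative bound is in fact an equality.
-/

/-! ### Real recursions over scales -/

/-- Induction over scales: a property of positive reals that holds above some threshold, and holds
at `δ` as soon as it holds at the larger scales `δ / a` and `δ / b`, holds everywhere. -/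
theorem scale_induction {a b δ₀ : ℝ} (ha : 0 < a) (ha1 : a < 1) (hb : 0 < b) (hb1 : b < 1)
    (hδ₀ : 0 < δ₀) {p : ℝ → Prop} (large : ∀ δ, δ₀ ≤ δ → p δ)
    (step : ∀ δ, 0 < δ → δ < δ₀ → p (δ / a) → p (δ / b) → p δ) :
    ∀ δ, 0 < δ → p δ := by
  have hM : 0 < max a b := lt_max_of_lt_left ha
  have hM1 : max a b < 1 := max_lt ha1 hb1
  have key : ∀ n : ℕ, ∀ δ, 0 < δ → δ₀ * max a b ^ n ≤ δ → p δ := by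
    intro n
    induction n with
    | zero => intro δ _ h; exact large δ (by simpa using h)
    | succ n ih =>
      intro δ hδ h
      rcases le_or_gt δ₀ δ with h0 | h0
      · exact large δ h0
      · have h1 : δ₀ * max a b ^ n * max a b ≤ δ := by rwa [pow_succ, ← mul_assoc] at h
        have hnn : 0 ≤ δ₀ * max a b ^ n := by positivity
        refine step δ hδ h0 (ih _ (by positivity) ?_) (ih _ (by positivity) ?_)
        · rw [le_div_iff₀ ha]
          exact (mul_le_mul_of_nonneg_left (le_max_left a b) hnn).trans h1
        · rw [le_div_iff₀ hb]
          exact (mul_le_mul_of_nonneg_left (le_max_right a b) hnn).trans h1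
  intro δ hδ
  obtain ⟨n, hn⟩ := exists_pow_lt_of_lt_one (div_pos hδ hδ₀) hM1
  refine key n δ hδ ?_
  rw [lt_div_iff₀ hδ₀] at hn
  linarith

theorem div_rpow_neg_eq {δ a s : ℝ} (hδ : 0 < δ) (ha : 0 < a) :
    (δ / a) ^ (-s) = a ^ s * δ ^ (-s) := by
  rw [Real.div_rpow hδ.le ha.le, Real.rpow_neg ha.le, div_inv_eq_mul, mul_comm]

/-- If the weights `w a ^ τ` and `w b ^ τ` add up to one, the recursion says that
`δ ^ τ * R δ` is at least a weighted mean of its values at larger scales. -/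
theorem exists_lower_bound_of_recursion {a b w τ : ℝ} (ha : 0 < a) (ha1 : a < 1) (hb : 0 < b)
    (hb1 : b < 1) (hw : 0 ≤ w) (hτ : τ < 0) (heq : w * (a ^ τ + b ^ τ) = 1) {R : ℝ → ℝ}
    (large : ∀ δ, 1 ≤ δ → R δ = 1)
    (step : ∀ δ, 0 < δ → δ < 1 → w * (R (δ / a) + R (δ / b)) ≤ R δ) :
    ∃ κ, 0 < κ ∧ ∀ δ, 0 < δ → δ ≤ 1 → κ * δ ^ (-τ) ≤ R δ := by
  have hm : 0 < min a b := lt_min ha hb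
  have hm1 : min a b < 1 := min_lt_of_left_lt ha1
  refine ⟨min a b ^ (-τ), by positivity, fun δ hδ hδ1 => ?_⟩
  -- scales up to `1 / min a b` are needed because one step may leave `(0, 1)`
  refine scale_induction ha ha1 hb hb1 one_pos
    (p := fun δ => δ ≤ 1 / min a b → min a b ^ (-τ) * δ ^ (-τ) ≤ R δ) ?_ ?_ δ hδ
    (hδ1.trans (by rw [le_div_iff₀ hm]; linarith))
  · intro δ h1 h2
    have h0 : 0 < δ := by linarith
    rw [large δ h1, ← Real.mul_rpow hm.le h0.le]
    refine Real.rpow_le_one (by positivity) ?_ (by linarith)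
    rwa [le_div_iff₀ hm, mul_comm] at h2
  · intro δ h0 h1 iha ihb _
    have h2 := iha (div_le_div₀ zero_le_one h1.le hm (min_le_left a b))
    have h3 := ihb (div_le_div₀ zero_le_one h1.le hm (min_le_right a b))
    rw [div_rpow_neg_eq h0 ha] at h2
    rw [div_rpow_neg_eq h0 hb] at h3
    calc min a b ^ (-τ) * δ ^ (-τ)
        = w * (a ^ τ + b ^ τ) * (min a b ^ (-τ) * δ ^ (-τ)) := by rw [heq, one_mul]
      _ = w * (min a b ^ (-τ) * (a ^ τ * δ ^ (-τ)) + min a b ^ (-τ) * (b ^ τ * δ ^ (-τ))) := by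
          ring
      _ ≤ w * (R (δ / a) + R (δ / b)) := mul_le_mul_of_nonneg_left (add_le_add h2 h3) hw
      _ ≤ R δ := step δ h0 h1

/-- As the weights `w a ^ σ` and `w b ^ σ` add up to less than one, an error of the order
`δ ^ (-σ)` in each step is absorbed by the constant. -/
theorem exists_upper_bound_of_recursion {a b w σ C : ℝ} (ha : 0 < a) (ha1 : a < 1) (hb : 0 < b)
    (hb1 : b < 1) (hw : 0 ≤ w) (hσ : σ < 0) (hlt : w * (a ^ σ + b ^ σ) < 1) {R : ℝ → ℝ}
    (large : ∀ δ, 1 ≤ δ → R δ = 1)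
    (step : ∀ δ, 0 < δ → δ < 1 → R δ ≤ w * (R (δ / a) + R (δ / b)) + C * δ ^ (-σ)) :
    ∃ A, 0 < A ∧ ∀ δ, 0 < δ → R δ ≤ A * δ ^ (-σ) := by
  set θ := w * (a ^ σ + b ^ σ) with hθ
  have hθ' : 0 < 1 - θ := by linarith
  have hA1 : 1 ≤ max 1 (C / (1 - θ)) := le_max_left _ _
  have hA2 : C ≤ max 1 (C / (1 - θ)) * (1 - θ) := by
    rw [← div_le_iff₀ hθ']; exact le_max_right _ _
  set A := max 1 (C / (1 - θ))
  refine ⟨A, by linarith, ?_⟩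
  refine scale_induction ha ha1 hb hb1 one_pos ?_ ?_
  · intro δ h1
    rw [large δ h1]
    exact one_le_mul_of_one_le_of_one_le hA1 (Real.one_le_rpow h1 (by linarith))
  · intro δ h0 h1 iha ihb
    rw [div_rpow_neg_eq h0 ha] at iha
    rw [div_rpow_neg_eq h0 hb] at ihb
    have hpos : 0 < δ ^ (-σ) := Real.rpow_pos_of_pos h0 _
    calc R δ ≤ w * (R (δ / a) + R (δ / b)) + C * δ ^ (-σ) := step δ h0 h1
      _ ≤ w * (A * (a ^ σ * δ ^ (-σ)) + A * (b ^ σ * δ ^ (-σ)))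
            + A * (1 - θ) * δ ^ (-σ) := by gcongr
      _ = A * δ ^ (-σ) := by rw [hθ]; ring

/-! ### Self-similar measures of two maps on the line -/

/-- `ν` is the self-similar measure on the line of the two maps `x ↦ a x` and
`x ↦ b x + (1 - b)`, with equal weights. -/
structure IsTwoMapMeasure (a b : ℝ) (ν : Measure ℝ) : Prop where
  prob : IsProbabilityMeasure ν
  invariant : ν = (1 / 2 : ℝ≥0∞) • ν.map (fun x => a * x) +
    (1 / 2 : ℝ≥0∞) • ν.map (fun x => b * x + (1 - b))

/-- The integral `∫ ν (B (x, δ)) ^ (q - 1) dν(x)`, of which the `L^q`-spectrum is the exponent. -/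
noncomputable def ballMoment (ν : Measure ℝ) (q δ : ℝ) : ℝ≥0∞ :=
  ∫⁻ x, ν (Metric.closedBall x δ) ^ (q - 1) ∂ν

theorem measurable_measure_closedBall (ν : Measure ℝ) [SFinite ν] (δ : ℝ) :
    Measurable fun x => ν (Metric.closedBall x δ) := by
  have h : MeasurableSet {z : ℝ × ℝ | dist z.2 z.1 ≤ δ} :=
    (isClosed_le (by fun_prop) (by fun_prop)).measurableSet
  exact measurable_measure_prodMk_left h

/-- For `p > 0`, `(u + v) ^ p` exceeds a multiple of `u ^ p`, with factor close to one, by at most a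
multiple of `v ^ p`. -/
theorem ENNReal.add_rpow_le_of_pos {p κ : ℝ} (hp : 0 < p) (hκ : 0 < κ) (u v : ℝ≥0∞) :
    (u + v) ^ p ≤ ENNReal.ofReal ((1 + κ) ^ p) * u ^ p +
      ENNReal.ofReal ((1 + κ⁻¹) ^ p) * v ^ p := by
  have hk : ENNReal.ofReal κ ≠ 0 := by simpa using hκ
  have h1 : ∀ t : ℝ, 0 < t → ENNReal.ofReal ((1 + t) ^ p) = (1 + ENNReal.ofReal t) ^ p := by
    intro t ht
    rw [← ENNReal.ofReal_rpow_of_pos (by linarith), ENNReal.ofReal_add zero_le_one ht.le,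
      ENNReal.ofReal_one]
  rw [h1 κ hκ, h1 _ (inv_pos.2 hκ), ← ENNReal.mul_rpow_of_nonneg _ _ hp.le,
    ← ENNReal.mul_rpow_of_nonneg _ _ hp.le]
  rcases le_total v (ENNReal.ofReal κ * u) with h | h
  · refine le_add_of_le_of_nonneg (ENNReal.rpow_le_rpow ?_ hp.le) zero_le
    rw [add_mul, one_mul]
    gcongr
  · refine le_add_of_nonneg_of_le zero_le (ENNReal.rpow_le_rpow ?_ hp.le)
    rw [add_mul, one_mul, add_comm, ENNReal.ofReal_inv_of_pos hκ]
    gcongr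
    calc u = (ENNReal.ofReal κ)⁻¹ * (ENNReal.ofReal κ * u) := by
          rw [← mul_assoc, ENNReal.inv_mul_cancel hk ENNReal.ofReal_ne_top, one_mul]
      _ ≤ _ := by gcongr

theorem ENNReal.half_mul_add_half_mul (x : ℝ≥0∞) : 1 / 2 * x + 1 / 2 * x = x := by
  rw [← add_mul, ENNReal.add_halves, one_mul]

theorem ENNReal.half_mul_half_rpow (q : ℝ) :
    (1 / 2 : ℝ≥0∞) * (1 / 2 : ℝ≥0∞) ^ (q - 1) = ENNReal.ofReal ((1 / 2) ^ q) := by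
  rw [← ENNReal.ofReal_rpow_of_pos (by norm_num), ENNReal.ofReal_div_of_pos (by norm_num)]
  simp only [ENNReal.ofReal_one, ENNReal.ofReal_ofNat]
  nth_rewrite 1 [← ENNReal.rpow_one (1 / 2)]
  rw [← ENNReal.rpow_add _ _ (by simp) (by simp)]
  congr 1
  ring

theorem closedBall_div_eq_preimage {r s : ℝ} (hr : 0 < r) (x δ : ℝ) :
    Metric.closedBall x (δ / r) = (fun y => r * y + s) ⁻¹' Metric.closedBall (r * x + s) δ := by
  ext y
  rw [Set.mem_preimage, Metric.mem_closedBall, Metric.mem_closedBall, Real.dist_eq, Real.dist_eq,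
    show r * y + s - (r * x + s) = r * (y - x) by ring, abs_mul, abs_of_pos hr, le_div_iff₀ hr,
    mul_comm]

namespace IsTwoMapMeasure

variable {a b : ℝ} {ν : Measure ℝ}

theorem measure_eq (h : IsTwoMapMeasure a b ν) {s : Set ℝ} (hs : MeasurableSet s) :
    ν s = 1 / 2 * ν ((fun x => a * x) ⁻¹' s) + 1 / 2 * ν ((fun x => b * x + (1 - b)) ⁻¹' s) := by
  conv_lhs => rw [h.invariant]
  rw [Measure.add_apply, Measure.smul_apply, Measure.smul_apply, Measure.map_apply (by fun_prop) hs,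
    Measure.map_apply (by fun_prop) hs, smul_eq_mul, smul_eq_mul]

theorem lintegral_eq (h : IsTwoMapMeasure a b ν) {f : ℝ → ℝ≥0∞} (hf : Measurable f) :
    ∫⁻ x, f x ∂ν = 1 / 2 * ∫⁻ x, f (a * x) ∂ν + 1 / 2 * ∫⁻ x, f (b * x + (1 - b)) ∂ν := by
  conv_lhs => rw [h.invariant]
  rw [lintegral_add_measure, lintegral_smul_measure, lintegral_smul_measure,
    lintegral_map hf (by fun_prop), lintegral_map hf (by fun_prop), smul_eq_mul, smul_eq_mul]

theorem measure_compl_Icc_le (h : IsTwoMapMeasure a b ν) (ha : 0 < a) (ha1 : a < 1) (hb : 0 < b)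
    (hb1 : b < 1) {r : ℝ} (hr : 0 < r) :
    ν (Set.Icc (-r) (1 + r))ᶜ ≤ ν (Set.Icc (-(r / max a b)) (1 + r / max a b))ᶜ := by
  have hM : 0 < max a b := lt_max_of_lt_left ha
  have h1 : a * (r / max a b) ≤ r := by
    rw [← mul_div_assoc, div_le_iff₀ hM, mul_comm]
    exact mul_le_mul_of_nonneg_left (le_max_left a b) hr.le
  have h2 : b * (r / max a b) ≤ r := by
    rw [← mul_div_assoc, div_le_iff₀ hM, mul_comm]
    exact mul_le_mul_of_nonneg_left (le_max_right a b) hr.le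
  rw [h.measure_eq measurableSet_Icc.compl,
    ← ENNReal.half_mul_add_half_mul (ν (Set.Icc (-(r / max a b)) (1 + r / max a b))ᶜ)]
  gcongr
  · intro x hx
    contrapose! hx
    simp only [Set.mem_compl_iff, not_not, Set.mem_Icc, Set.mem_preimage] at hx ⊢
    constructor <;> nlinarith
  · intro x hx
    contrapose! hx
    simp only [Set.mem_compl_iff, not_not, Set.mem_Icc, Set.mem_preimage] at hx ⊢
    constructor <;> nlinarith

/-- Pulling back by the contractions pushes the mass outside a neighbourhood of `[0, 1]` to
infinity. -/
theorem measure_compl_Icc_eq_zero (h : IsTwoMapMeasure a b ν) (ha : 0 < a) (ha1 : a < 1)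
    (hb : 0 < b) (hb1 : b < 1) : ν (Set.Icc 0 1)ᶜ = 0 := by
  have := h.prob
  have hM : 0 < max a b := lt_max_of_lt_left ha
  have hM1 : max a b < 1 := max_lt ha1 hb1
  have key : ∀ r : ℝ, 0 < r → ν (Set.Icc (-r) (1 + r))ᶜ = 0 := by
    intro r hr
    have hle : ∀ n : ℕ, ν (Set.Icc (-r) (1 + r))ᶜ ≤
        ν (Set.Icc (-(r / max a b ^ n)) (1 + r / max a b ^ n))ᶜ := by
      intro n
      induction n with
      | zero => simp
      | succ n ih =>
        refine ih.trans ((h.measure_compl_Icc_le ha ha1 hb hb1 (by positivity)).trans_eq ?_)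
        rw [div_div, ← pow_succ]
    have hinf : Tendsto (fun n : ℕ => r / max a b ^ n) atTop atTop := by
      have := (tendsto_pow_atTop_atTop_of_one_lt ((one_lt_inv₀ hM).2 hM1)).const_mul_atTop hr
      simpa only [inv_pow, ← div_eq_mul_inv] using this
    have hmono : Monotone fun n : ℕ => r / max a b ^ n := by
      intro m n hmn
      exact div_le_div_of_nonneg_left hr.le (by positivity)
        (pow_le_pow_of_le_one hM.le hM1.le hmn)
    have hlim := tendsto_measure_iInter_atTop (μ := ν)
      (s := fun n : ℕ => (Set.Icc (-(r / max a b ^ n)) (1 + r / max a b ^ n))ᶜ)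
      (fun n => measurableSet_Icc.compl.nullMeasurableSet)
      (fun m n hmn => Set.compl_subset_compl.2 (Set.Icc_subset_Icc
        (neg_le_neg (hmono hmn)) (by have := hmono hmn; dsimp only at this ⊢; linarith)))
      ⟨0, measure_ne_top _ _⟩
    have hempty : ⋂ n : ℕ, (Set.Icc (-(r / max a b ^ n)) (1 + r / max a b ^ n))ᶜ = ∅ := by
      refine Set.eq_empty_of_forall_notMem fun x hx => ?_
      obtain ⟨n, hn⟩ := (hinf.eventually_ge_atTop |x|).exists
      refine Set.mem_iInter.1 hx n ⟨?_, ?_⟩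
      · linarith [neg_abs_le x]
      · linarith [le_abs_self x]
    rw [hempty, measure_empty] at hlim
    exact le_antisymm (ge_of_tendsto' hlim hle) zero_le
  refine measure_mono_null (t := ⋃ n : ℕ, (Set.Icc (-(1 / ((n : ℝ) + 1)))
    (1 + 1 / ((n : ℝ) + 1)))ᶜ) ?_ (measure_iUnion_null fun n => key _ (by positivity))
  intro x hx
  by_contra hcon
  simp only [Set.mem_iUnion, Set.mem_compl_iff, not_exists, not_not, Set.mem_Icc] at hcon
  refine hx ⟨le_of_forall_pos_le_add fun ε hε => ?_, le_of_forall_pos_le_add fun ε hε => ?_⟩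
  · obtain ⟨n, hn⟩ := exists_nat_one_div_lt hε
    linarith [(hcon n).1]
  · obtain ⟨n, hn⟩ := exists_nat_one_div_lt hε
    linarith [(hcon n).2]

theorem ae_mem_Icc (h : IsTwoMapMeasure a b ν) (ha : 0 < a) (ha1 : a < 1)
    (hb : 0 < b) (hb1 : b < 1) : ∀ᵐ x ∂ν, x ∈ Set.Icc (0 : ℝ) 1 :=
  h.measure_compl_Icc_eq_zero ha ha1 hb hb1

theorem ballMoment_ne_top (h : IsTwoMapMeasure a b ν) {q : ℝ} (hq : 1 < q) (δ : ℝ) :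
    ballMoment ν q δ ≠ ∞ := by
  have := h.prob
  refine ne_top_of_le_ne_top ENNReal.one_ne_top ?_
  calc ballMoment ν q δ ≤ ∫⁻ _, 1 ∂ν :=
        lintegral_mono fun x => ENNReal.rpow_le_one prob_le_one (by linarith)
    _ = 1 := by simp

theorem ballMoment_eq_one (h : IsTwoMapMeasure a b ν) (ha : 0 < a) (ha1 : a < 1)
    (hb : 0 < b) (hb1 : b < 1) (q : ℝ) {δ : ℝ} (hδ : 1 ≤ δ) :
    ballMoment ν q δ = 1 := by
  have := h.prob
  have hae := h.ae_mem_Icc ha ha1 hb hb1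
  have h1 : ∀ᵐ x ∂ν, ν (Metric.closedBall x δ) ^ (q - 1) = 1 := by
    filter_upwards [hae] with x hx
    have : ν (Metric.closedBall x δ) = 1 := by
      rw [prob_compl_eq_zero_iff₀ Metric.isClosed_closedBall.measurableSet.nullMeasurableSet |>.1]
      refine measure_mono_null (Set.compl_subset_compl.2 ?_)
        (h.measure_compl_Icc_eq_zero ha ha1 hb hb1)
      intro y hy
      rw [Real.closedBall_eq_Icc]
      exact ⟨by linarith [hx.2, hy.1], by linarith [hx.1, hy.2]⟩
    rw [this, ENNReal.one_rpow]
  rw [ballMoment, lintegral_congr_ae h1]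
  simp

theorem le_ballMoment (h : IsTwoMapMeasure a b ν) (ha : 0 < a) (hb : 0 < b) {q : ℝ} (hq : 1 < q)
    (δ : ℝ) :
    ENNReal.ofReal ((1 / 2) ^ q) * (ballMoment ν q (δ / a) + ballMoment ν q (δ / b)) ≤
      ballMoment ν q δ := by
  have := h.prob
  have hq' : 0 ≤ q - 1 := by linarith
  have hm := measurable_measure_closedBall ν
  conv_rhs => rw [ballMoment, h.lintegral_eq ((hm δ).pow_const _)]
  rw [← ENNReal.half_mul_half_rpow, mul_add, mul_assoc, mul_assoc, ballMoment, ballMoment,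
    ← lintegral_const_mul _ ((hm _).pow_const _), ← lintegral_const_mul _ ((hm _).pow_const _)]
  gcongr with x x
  · rw [← ENNReal.mul_rpow_of_nonneg _ _ hq']
    refine ENNReal.rpow_le_rpow ?_ hq'
    rw [h.measure_eq (s := Metric.closedBall (a * x) δ) Metric.isClosed_closedBall.measurableSet]
    refine le_trans (le_of_eq ?_) le_self_add
    have := closedBall_div_eq_preimage (s := 0) ha x δ
    simp only [add_zero] at this
    rw [this]
  · rw [← ENNReal.mul_rpow_of_nonneg _ _ hq']
    refine ENNReal.rpow_le_rpow ?_ hq'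
    rw [h.measure_eq (s := Metric.closedBall (b * x + (1 - b)) δ)
      Metric.isClosed_closedBall.measurableSet]
    refine le_trans (le_of_eq ?_) le_add_self
    rw [closedBall_div_eq_preimage (s := 1 - b) hb x δ]

theorem measure_Iic_eq (h : IsTwoMapMeasure a b ν) (ha : 0 < a) (ha1 : a < 1)
    (hb : 0 < b) (hb1 : b < 1) {r : ℝ} (hr : r < 1 - b) :
    ν (Set.Iic r) = 1 / 2 * ν (Set.Iic (r / a)) := by
  have h0 : ν ((fun x => b * x + (1 - b)) ⁻¹' Set.Iic r) = 0 := by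
    refine measure_mono_null ?_ (h.measure_compl_Icc_eq_zero ha ha1 hb hb1)
    intro x hx hx'
    simp only [Set.mem_preimage, Set.mem_Iic] at hx
    nlinarith [hx'.1]
  have h1 : (fun x => a * x) ⁻¹' Set.Iic r = Set.Iic (r / a) := by
    ext x
    simp only [Set.mem_preimage, Set.mem_Iic]
    rw [le_div_iff₀ ha, mul_comm]
  rw [h.measure_eq measurableSet_Iic, h0, h1, mul_zero, add_zero]

theorem measure_Ici_eq (h : IsTwoMapMeasure a b ν) (ha : 0 < a) (ha1 : a < 1)
    (hb : 0 < b) (hb1 : b < 1) {r : ℝ} (hr : r < 1 - a) :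
    ν (Set.Ici (1 - r)) = 1 / 2 * ν (Set.Ici (1 - r / b)) := by
  have h0 : ν ((fun x => a * x) ⁻¹' Set.Ici (1 - r)) = 0 := by
    refine measure_mono_null ?_ (h.measure_compl_Icc_eq_zero ha ha1 hb hb1)
    intro x hx hx'
    simp only [Set.mem_preimage, Set.mem_Ici] at hx
    nlinarith [hx'.2]
  have h1 : (fun x => b * x + (1 - b)) ⁻¹' Set.Ici (1 - r) = Set.Ici (1 - r / b) := by
    ext x
    simp only [Set.mem_preimage, Set.mem_Ici]
    rw [sub_le_comm (b := r / b), le_div_iff₀ hb]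
    constructor <;> intro h <;> linarith
  rw [h.measure_eq measurableSet_Ici, h0, h1, mul_zero, zero_add]

end IsTwoMapMeasure

/-- A distribution function that halves when the scale shrinks by the factor `a` satisfies
`g ^ q ≤ C r ^ (-τ)` as soon as `2 ^ (-q) a ^ τ ≤ 1`. -/
theorem rpow_le_of_halving {g : ℝ → ℝ} {a r₀ q τ : ℝ} (ha : 0 < a) (ha1 : a < 1) (hr₀ : 0 < r₀)
    (hq : 0 < q) (hτ : τ < 0) (hle : (1 / 2) ^ q * a ^ τ ≤ 1) (h0 : ∀ r, 0 ≤ g r)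
    (h1 : ∀ r, g r ≤ 1) (half : ∀ r, 0 < r → r < r₀ → g r = 1 / 2 * g (r / a)) :
    ∀ r, 0 < r → g r ^ q ≤ r₀ ^ τ * r ^ (-τ) := by
  refine scale_induction ha ha1 ha ha1 hr₀ ?_ ?_
  · intro r hr
    have hr' : 0 < r := by linarith
    calc g r ^ q ≤ 1 := Real.rpow_le_one (h0 r) (h1 r) hq.le
      _ = r ^ τ * r ^ (-τ) := by rw [← Real.rpow_add hr']; simp
      _ ≤ r₀ ^ τ * r ^ (-τ) := mul_le_mul_of_nonneg_right
          (Real.rpow_le_rpow_of_nonpos hr₀ hr hτ.le) (by positivity)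
  · intro r hr hr1 ih _
    rw [div_rpow_neg_eq hr ha] at ih
    rw [half r hr hr1, Real.mul_rpow (by norm_num) (h0 _)]
    calc (1 / 2) ^ q * g (r / a) ^ q
        ≤ (1 / 2) ^ q * (r₀ ^ τ * (a ^ τ * r ^ (-τ))) := by gcongr
      _ = ((1 / 2) ^ q * a ^ τ) * (r₀ ^ τ * r ^ (-τ)) := by ring
      _ ≤ r₀ ^ τ * r ^ (-τ) := mul_le_of_le_one_left (by positivity) hle

/-! ### The `L^q`-spectrum of the self-similar measures -/

/-- Two-sided power bounds for the ball moment, the upper one up to an arbitrarily small loss in the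
exponent, determine the `L^q`-spectrum. -/
theorem hasLqSpectrum_of_bounds {ν : Measure ℝ} {q τ : ℝ} (hτ : τ < 0)
    (hfin : ∀ δ, ballMoment ν q δ ≠ ∞)
    (lower : ∃ κ, 0 < κ ∧ ∀ δ, 0 < δ → δ ≤ 1 → κ * δ ^ (-τ) ≤ (ballMoment ν q δ).toReal)
    (upper : ∀ σ, τ < σ → σ < 0 → ∃ A, 0 < A ∧
      ∀ δ, 0 < δ → (ballMoment ν q δ).toReal ≤ A * δ ^ (-σ)) :
    HasLqSpectrum ν q τ := by
  obtain ⟨κ, hκ, lower⟩ := lower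
  have hlog : Tendsto (fun δ : ℝ => -Real.log δ) (𝓝[>] 0) atTop :=
    tendsto_neg_atBot_atTop.comp Real.tendsto_log_nhdsGT_zero
  have hev : ∀ᶠ δ : ℝ in 𝓝[>] 0, 0 < δ ∧ δ < 1 := Ioo_mem_nhdsGT one_pos
  have hlim : ∀ K s : ℝ, Tendsto (fun δ : ℝ => Real.log K / -Real.log δ + s) (𝓝[>] 0) (𝓝 s) := by
    intro K s
    simpa using (hlog.const_div_atTop (Real.log K)).add_const s
  have hform : ∀ K s δ : ℝ, 0 < K → 0 < δ → δ < 1 →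
      Real.log (K * δ ^ (-s)) / -Real.log δ = Real.log K / -Real.log δ + s := by
    intro K s δ hK h0 h1
    have : Real.log δ ≠ 0 := (Real.log_neg h0 h1).ne
    rw [Real.log_mul hK.ne' (Real.rpow_pos_of_pos h0 _).ne', Real.log_rpow h0]
    field_simp
    ring
  have hpos : ∀ δ, 0 < δ → δ < 1 → 0 < (ballMoment ν q δ).toReal := fun δ h0 h1 =>
    (mul_pos hκ (Real.rpow_pos_of_pos h0 _)).trans_le (lower δ h0 h1.le)
  have hreal : Tendsto (fun δ : ℝ => Real.log (ballMoment ν q δ).toReal / -Real.log δ)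
      (𝓝[>] 0) (𝓝 τ) := by
    refine tendsto_order.2 ⟨fun l hl => ?_, fun u hu => ?_⟩
    · filter_upwards [hev, (tendsto_order.1 (hlim κ τ)).1 l hl] with δ hδ hδ'
      rw [← hform κ τ δ hκ hδ.1 hδ.2] at hδ'
      refine hδ'.trans_le ?_
      have hneg : 0 ≤ -Real.log δ := by linarith [Real.log_neg hδ.1 hδ.2]
      have := Real.rpow_pos_of_pos hδ.1 (-τ)
      exact div_le_div_of_nonneg_right
        (Real.log_le_log (by positivity) (lower δ hδ.1 hδ.2.le)) hneg
    · obtain ⟨σ, h1, h2⟩ := exists_between (lt_min hu hτ)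
      obtain ⟨A, hA, upper⟩ := upper σ h1 (h2.trans_le (min_le_right _ _))
      filter_upwards [hev, (tendsto_order.1 (hlim A σ)).2 u (h2.trans_le (min_le_left _ _))]
        with δ hδ hδ'
      rw [← hform A σ δ hA hδ.1 hδ.2] at hδ'
      refine lt_of_le_of_lt ?_ hδ'
      have hneg : 0 ≤ -Real.log δ := by linarith [Real.log_neg hδ.1 hδ.2]
      exact div_le_div_of_nonneg_right
        (Real.log_le_log (hpos δ hδ.1 hδ.2) (upper δ hδ.1)) hneg
  have hE : Tendsto (fun δ : ℝ =>
      ENNReal.log (∫⁻ x in ν.support, ν (Metric.closedBall x δ) ^ (q - 1) ∂ν) /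
        ((-Real.log δ : ℝ) : EReal)) (𝓝[>] 0) (𝓝 (τ : EReal)) := by
    refine Tendsto.congr' ?_ ((continuous_coe_real_ereal.tendsto τ).comp hreal)
    filter_upwards [hev] with δ hδ
    have hs : ∀ᵐ x ∂ν, x ∈ ν.support := Measure.support_mem_ae
    rw [Measure.restrict_eq_self_of_ae_mem hs]
    change _ = ENNReal.log (ballMoment ν q δ) / _
    conv_rhs => rw [← ENNReal.ofReal_toReal (hfin δ)]
    rw [ENNReal.log_ofReal_of_pos (hpos δ hδ.1 hδ.2), ← EReal.coe_div]
    rfl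
  exact ⟨hE.limsup_eq, hE.liminf_eq⟩

namespace IsTwoMapMeasure

variable {a b : ℝ} {ν : Measure ℝ}

/-- If the `ν`-measure of the ball around `f x` is half the measure of a ball around `x`, up to an
error `g` that occurs only for `x ∈ s`, then the `(q - 1)`-st moments compare accordingly. -/
theorem lintegral_closedBall_comp_le [SFinite ν] {q κ δ δ' : ℝ} (hq : 1 < q) (hκ : 0 < κ)
    {f : ℝ → ℝ} {s : Set ℝ} (hs : MeasurableSet s) {g : ℝ≥0∞}
    (hf : ∀ᵐ x ∂ν, ν (Metric.closedBall (f x) δ) ≤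
      1 / 2 * ν (Metric.closedBall x δ') + s.indicator (fun _ => g) x) :
    ∫⁻ x, ν (Metric.closedBall (f x) δ) ^ (q - 1) ∂ν ≤
      ENNReal.ofReal ((1 + κ) ^ (q - 1)) * ((1 / 2) ^ (q - 1) * ballMoment ν q δ') +
        ENNReal.ofReal ((1 + κ⁻¹) ^ (q - 1)) * (g ^ (q - 1) * ν s) := by
  have hp : 0 < q - 1 := by linarith
  have hm := (measurable_measure_closedBall ν δ').pow_const (q - 1)
  rw [← lintegral_indicator_const hs, ballMoment, ← lintegral_const_mul _ hm,
    ← lintegral_const_mul _ (hm.const_mul _),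
    ← lintegral_const_mul _ (measurable_const.indicator hs),
    ← lintegral_add_left ((hm.const_mul _).const_mul _)]
  refine lintegral_mono_ae ?_
  filter_upwards [hf] with x hx
  refine (ENNReal.rpow_le_rpow hx hp.le).trans ((ENNReal.add_rpow_le_of_pos hp hκ _ _).trans_eq ?_)
  rw [ENNReal.mul_rpow_of_nonneg _ _ hp.le]
  congr 2
  by_cases hxs : x ∈ s
  · simp [hxs]
  · simp [hxs, hp]

theorem rpow_mul_le_add {q : ℝ} (hq : 1 < q) (u v : ℝ≥0∞) :
    u ^ (q - 1) * v ≤ u ^ q + v ^ q := by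
  have key : ∀ w : ℝ≥0∞, w ^ (q - 1) * w = w ^ q := by
    intro w
    have := ENNReal.rpow_add_of_nonneg (x := w) (q - 1) 1 (by linarith) zero_le_one
    rw [sub_add_cancel, ENNReal.rpow_one] at this
    exact this.symm
  rcases le_total u v with h | h
  · calc u ^ (q - 1) * v ≤ v ^ (q - 1) * v := by
          gcongr
      _ = v ^ q := key v
      _ ≤ _ := le_add_self
  · calc u ^ (q - 1) * v ≤ u ^ (q - 1) * u := by gcongr
      _ = u ^ q := key u
      _ ≤ _ := le_self_add

/-- The two halves of the support touch at most at one point, so a ball centred in one half meets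
the other only near the end points; this bounds the failure of exact self-similarity. -/
theorem ballMoment_le (h : IsTwoMapMeasure a b ν) (ha : 0 < a) (ha1 : a < 1) (hb : 0 < b)
    (hb1 : b < 1) (hab : a + b ≤ 1) {q κ : ℝ} (hq : 1 < q) (hκ : 0 < κ) (δ : ℝ) :
    ballMoment ν q δ ≤ ENNReal.ofReal ((1 + κ) ^ (q - 1)) * (ENNReal.ofReal ((1 / 2) ^ q) *
        (ballMoment ν q (δ / a) + ballMoment ν q (δ / b))) +
      ENNReal.ofReal ((1 + κ⁻¹) ^ (q - 1)) *
        (ν (Set.Iic (δ / b)) ^ q + ν (Set.Ici (1 - δ / a)) ^ q) := by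
  have := h.prob
  have hae := h.ae_mem_Icc ha ha1 hb hb1
  have hball : ∀ y : ℝ, MeasurableSet (Metric.closedBall y δ) := fun y =>
    Metric.isClosed_closedBall.measurableSet
  have key1 := lintegral_closedBall_comp_le (ν := ν) (δ := δ) (δ' := δ / a) (κ := κ) hq hκ
    (f := fun x => a * x) (s := Set.Ici (1 - δ / a)) measurableSet_Ici
    (g := ν (Set.Iic (δ / b))) (by
      filter_upwards [hae] with x hx
      rw [h.measure_eq (hball (a * x))]
      have hpre := closedBall_div_eq_preimage (s := 0) ha x δ
      simp only [add_zero] at hpre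
      rw [hpre]
      gcongr
      refine (mul_le_of_le_one_left zero_le (by simp)).trans ?_
      -- only the part of the preimage in `[0, 1]` carries mass
      have hle : ν ((fun y => b * y + (1 - b)) ⁻¹' Metric.closedBall (a * x) δ) ≤
          ν ({y | y ≤ δ / b ∧ 1 - δ / a ≤ x}) := by
        refine measure_mono_ae ?_
        filter_upwards [hae] with y hy hxy
        have hxy' : b * y + (1 - b) ≤ a * x + δ := by
          have : b * y + (1 - b) ∈ Metric.closedBall (a * x) δ := hxy
          rw [Real.closedBall_eq_Icc] at this
          exact this.2
        refine ⟨?_, ?_⟩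
        · rw [le_div_iff₀ hb]; nlinarith [hx.2]
        · rw [sub_le_comm, le_div_iff₀ ha]; nlinarith [hy.1]
      refine hle.trans ?_
      by_cases hx' : 1 - δ / a ≤ x
      · rw [Set.indicator_of_mem (by exact hx')]
        exact measure_mono fun y hy => hy.1
      · simp [hx'])
  have key2 := lintegral_closedBall_comp_le (ν := ν) (δ := δ) (δ' := δ / b) (κ := κ) hq hκ
    (f := fun x => b * x + (1 - b)) (s := Set.Iic (δ / b)) measurableSet_Iic
    (g := ν (Set.Ici (1 - δ / a))) (by
      filter_upwards [hae] with x hx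
      rw [h.measure_eq (hball (b * x + (1 - b))), closedBall_div_eq_preimage (s := 1 - b) hb x δ,
        add_comm]
      gcongr
      refine (mul_le_of_le_one_left zero_le (by simp)).trans ?_
      have hle : ν ((fun y => a * y) ⁻¹' Metric.closedBall (b * x + (1 - b)) δ) ≤
          ν ({y | 1 - δ / a ≤ y ∧ x ≤ δ / b}) := by
        refine measure_mono_ae ?_
        filter_upwards [hae] with y hy hxy
        have hxy' : b * x + (1 - b) - δ ≤ a * y := by
          have : a * y ∈ Metric.closedBall (b * x + (1 - b)) δ := hxy
          rw [Real.closedBall_eq_Icc] at this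
          exact this.1
        refine ⟨?_, ?_⟩
        · rw [sub_le_comm, le_div_iff₀ ha]; nlinarith [hx.1]
        · rw [le_div_iff₀ hb]; nlinarith [hy.2]
      refine hle.trans ?_
      by_cases hx' : x ≤ δ / b
      · rw [Set.indicator_of_mem (by exact hx')]
        exact measure_mono fun y hy => hy.1
      · simp [hx'])
  have hm := (measurable_measure_closedBall ν δ).pow_const (q - 1)
  rw [ballMoment, h.lintegral_eq hm]
  have e1 := rpow_mul_le_add hq (ν (Set.Iic (δ / b))) (ν (Set.Ici (1 - δ / a)))
  have e2 := rpow_mul_le_add hq (ν (Set.Ici (1 - δ / a))) (ν (Set.Iic (δ / b)))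
  rw [add_comm (_ ^ q)] at e2
  set E := ν (Set.Iic (δ / b)) ^ q + ν (Set.Ici (1 - δ / a)) ^ q
  set K₁ := ENNReal.ofReal ((1 + κ) ^ (q - 1))
  set K₂ := ENNReal.ofReal ((1 + κ⁻¹) ^ (q - 1))
  calc _ ≤ 1 / 2 * (K₁ * ((1 / 2) ^ (q - 1) * ballMoment ν q (δ / a)) + K₂ * E) +
        1 / 2 * (K₁ * ((1 / 2) ^ (q - 1) * ballMoment ν q (δ / b)) + K₂ * E) := by
        gcongr
        · exact key1.trans (by gcongr)
        · exact key2.trans (by gcongr)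
    _ = K₁ * (1 / 2 * (1 / 2) ^ (q - 1) * (ballMoment ν q (δ / a) + ballMoment ν q (δ / b))) +
        (1 / 2 * (K₂ * E) + 1 / 2 * (K₂ * E)) := by ring
    _ = _ := by rw [ENNReal.half_mul_half_rpow, ENNReal.half_mul_add_half_mul]

theorem toReal_ballMoment_le (h : IsTwoMapMeasure a b ν) (ha : 0 < a) (ha1 : a < 1) (hb : 0 < b)
    (hb1 : b < 1) (hab : a + b ≤ 1) {q κ : ℝ} (hq : 1 < q) (hκ : 0 < κ) (δ : ℝ) :
    (ballMoment ν q δ).toReal ≤ (1 + κ) ^ (q - 1) * (1 / 2) ^ q *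
        ((ballMoment ν q (δ / a)).toReal + (ballMoment ν q (δ / b)).toReal) +
      (1 + κ⁻¹) ^ (q - 1) *
        (ν.real (Set.Iic (δ / b)) ^ q + ν.real (Set.Ici (1 - δ / a)) ^ q) := by
  have := h.prob
  have hq0 : 0 ≤ q := by linarith
  have hfin := h.ballMoment_ne_top hq
  have hrp : ∀ s : Set ℝ, ν s ^ q ≠ ∞ := fun s =>
    ENNReal.rpow_ne_top_of_nonneg hq0 (measure_ne_top ν s)
  have t1 : ENNReal.ofReal ((1 + κ) ^ (q - 1)) * (ENNReal.ofReal ((1 / 2) ^ q) *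
      (ballMoment ν q (δ / a) + ballMoment ν q (δ / b))) ≠ ∞ :=
    ENNReal.mul_ne_top ENNReal.ofReal_ne_top (ENNReal.mul_ne_top ENNReal.ofReal_ne_top
      (ENNReal.add_ne_top.2 ⟨hfin _, hfin _⟩))
  have t2 : ENNReal.ofReal ((1 + κ⁻¹) ^ (q - 1)) *
      (ν (Set.Iic (δ / b)) ^ q + ν (Set.Ici (1 - δ / a)) ^ q) ≠ ∞ :=
    ENNReal.mul_ne_top ENNReal.ofReal_ne_top (ENNReal.add_ne_top.2 ⟨hrp _, hrp _⟩)
  refine (ENNReal.toReal_mono (ENNReal.add_ne_top.2 ⟨t1, t2⟩)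
    (h.ballMoment_le ha ha1 hb hb1 hab hq hκ δ)).trans_eq ?_
  rw [ENNReal.toReal_add t1 t2, ENNReal.toReal_mul, ENNReal.toReal_mul, ENNReal.toReal_mul,
    ENNReal.toReal_add (hfin _) (hfin _), ENNReal.toReal_add (hrp _) (hrp _),
    ENNReal.toReal_ofReal (by positivity), ENNReal.toReal_ofReal (by positivity),
    ENNReal.toReal_ofReal (by positivity), ← ENNReal.toReal_rpow, ← ENNReal.toReal_rpow, mul_assoc]
  rfl

/-- The ends of the support carry so little mass that the errors near the end points are of the
order of the main term. -/
theorem measureReal_ends_le (h : IsTwoMapMeasure a b ν) (ha : 0 < a) (ha1 : a < 1) (hb : 0 < b)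
    (hb1 : b < 1) {q τ : ℝ} (hq : 1 < q) (hτ : τ < 0) (heq : (1 / 2) ^ q * (a ^ τ + b ^ τ) = 1) :
    ∃ C, 0 ≤ C ∧ ∀ δ, 0 < δ →
      ν.real (Set.Iic (δ / b)) ^ q + ν.real (Set.Ici (1 - δ / a)) ^ q ≤ C * δ ^ (-τ) := by
  have := h.prob
  have hq0 : 0 < q := by linarith
  have hA : (1 / 2) ^ q * a ^ τ ≤ 1 := by
    refine le_trans ?_ heq.le
    gcongr
    linarith [Real.rpow_pos_of_pos hb τ]
  have hB : (1 / 2) ^ q * b ^ τ ≤ 1 := by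
    refine le_trans ?_ heq.le
    gcongr
    linarith [Real.rpow_pos_of_pos ha τ]
  have hl := rpow_le_of_halving (g := fun r => ν.real (Set.Iic r)) ha ha1
    (show 0 < 1 - b by linarith) hq0 hτ hA (fun _ => measureReal_nonneg)
    (fun _ => measureReal_le_one) (fun r _ hr => by
      simp [Measure.real, h.measure_Iic_eq ha ha1 hb hb1 hr])
  have hr := rpow_le_of_halving (g := fun r => ν.real (Set.Ici (1 - r))) hb hb1
    (show 0 < 1 - a by linarith) hq0 hτ hB (fun _ => measureReal_nonneg)
    (fun _ => measureReal_le_one) (fun r _ hr => by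
      simp [Measure.real, h.measure_Ici_eq ha ha1 hb hb1 hr])
  have hb1' : 0 < 1 - b := by linarith
  have ha1' : 0 < 1 - a := by linarith
  refine ⟨(1 - b) ^ τ * b ^ τ + (1 - a) ^ τ * a ^ τ, by positivity, fun δ hδ => ?_⟩
  have h1 := hl (δ / b) (by positivity)
  have h2 := hr (δ / a) (by positivity)
  rw [div_rpow_neg_eq hδ hb] at h1
  rw [div_rpow_neg_eq hδ ha] at h2
  calc _ ≤ _ := add_le_add h1 h2
    _ = _ := by ring

/-- The `L^q`-spectrum of the self-similar measure is the root of `2 ^ (-q) (a ^ τ + b ^ τ) = 1`. -/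
theorem hasLqSpectrum (h : IsTwoMapMeasure a b ν) (ha : 0 < a) (ha1 : a < 1) (hb : 0 < b)
    (hb1 : b < 1) (hab : a + b ≤ 1) {q τ : ℝ} (hq : 1 < q) (hτ : τ < 0)
    (heq : (1 / 2) ^ q * (a ^ τ + b ^ τ) = 1) : HasLqSpectrum ν q τ := by
  have hfin := h.ballMoment_ne_top hq
  have hone : ∀ δ, 1 ≤ δ → (ballMoment ν q δ).toReal = 1 := fun δ hδ => by
    rw [h.ballMoment_eq_one ha ha1 hb hb1 q hδ, ENNReal.toReal_one]
  refine hasLqSpectrum_of_bounds hτ hfin ?_ fun σ hτσ hσ => ?_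
  · refine exists_lower_bound_of_recursion ha ha1 hb hb1 (w := (1 / 2) ^ q) (by positivity) hτ heq
      hone fun δ _ _ => ?_
    have := ENNReal.toReal_mono (hfin δ) (h.le_ballMoment ha hb hq δ)
    rwa [ENNReal.toReal_mul, ENNReal.toReal_add (hfin _) (hfin _),
      ENNReal.toReal_ofReal (by positivity)] at this
  · have hlt : (1 / 2) ^ q * (a ^ σ + b ^ σ) < 1 := by
      refine lt_of_lt_of_eq ?_ heq
      gcongr ?_ * (?_ + ?_)
      · exact Real.rpow_lt_rpow_of_exponent_gt ha ha1 hτσ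
      · exact Real.rpow_lt_rpow_of_exponent_gt hb hb1 hτσ
    -- the loss `κ` is chosen small enough that the recursion at the exponent `σ` still contracts
    obtain ⟨κ, hκ, hκlt⟩ : ∃ κ : ℝ, 0 < κ ∧
        (1 + κ) ^ (q - 1) * (1 / 2) ^ q * (a ^ σ + b ^ σ) < 1 := by
      have hc : Tendsto (fun κ : ℝ => (1 + κ) ^ (q - 1) * (1 / 2) ^ q * (a ^ σ + b ^ σ)) (𝓝[>] 0)
          (𝓝 ((1 / 2) ^ q * (a ^ σ + b ^ σ))) := by
        have : ContinuousAt
            (fun κ : ℝ => (1 + κ) ^ (q - 1) * (1 / 2) ^ q * (a ^ σ + b ^ σ)) 0 := by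
          refine ((ContinuousAt.rpow_const (by fun_prop) (Or.inl (by simp))).mul_const _).mul_const _
        simpa using this.tendsto.mono_left nhdsWithin_le_nhds
      obtain ⟨κ, h1, h2⟩ := ((tendsto_order.1 hc).2 1 hlt |>.and self_mem_nhdsWithin).exists
      exact ⟨κ, h2, h1⟩
    obtain ⟨C, hC, hends⟩ := h.measureReal_ends_le ha ha1 hb hb1 hq hτ heq
    refine exists_upper_bound_of_recursion (C := (1 + κ⁻¹) ^ (q - 1) * C) ha ha1 hb hb1
      (by positivity) hσ hκlt hone fun δ h0 h1 => ?_
    refine (h.toReal_ballMoment_le ha ha1 hb hb1 hab hq hκ δ).trans ?_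
    have hpow : δ ^ (-τ) ≤ δ ^ (-σ) := Real.rpow_le_rpow_of_exponent_ge h0 h1.le (by linarith)
    rw [mul_assoc _ C]
    gcongr
    exact (hends δ h0).trans (by gcongr)

end IsTwoMapMeasure

/-! ### The pressure -/

/-- Geometric bounds determine the growth rate, even with a loss of a linear factor. -/
theorem tendsto_rpow_one_div_of_bounds {u : ℕ → ℝ} {κ K M : ℝ} (hκ : 0 < κ) (hK : 0 < K)
    (hM : 0 < M) (lower : ∀ k : ℕ, κ * M ^ k ≤ (k + 1) * u k) (upper : ∀ k, u k ≤ K * M ^ k) :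
    Tendsto (fun k : ℕ => u k ^ (1 / (k : ℝ))) atTop (𝓝 M) := by
  have hinv : Tendsto (fun k : ℕ => 1 / (k : ℝ)) atTop (𝓝 0) := tendsto_one_div_atTop_nhds_zero_nat
  have hconst : ∀ L : ℝ, 0 < L → Tendsto (fun k : ℕ => L ^ (1 / (k : ℝ))) atTop (𝓝 1) := by
    intro L hL
    have h := ((Real.continuous_const_rpow hL.ne').tendsto 0).comp hinv
    rw [Real.rpow_zero] at h
    exact h
  have hpow : ∀ k : ℕ, 0 < k → (M ^ k) ^ (1 / (k : ℝ)) = M := by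
    intro k hk
    rw [one_div]
    exact Real.pow_rpow_inv_natCast hM.le hk.ne'
  have hlow : ∀ k : ℕ, 0 < k → κ / 2 / k * M ^ k ≤ u k := by
    intro k hk
    have hk' : (1 : ℝ) ≤ k := by exact_mod_cast hk
    have hu : 0 ≤ u k := by
      have h1 := lower k
      have h2 : 0 < κ * M ^ k := by positivity
      by_contra hneg
      nlinarith
    rw [div_div, div_mul_eq_mul_div, div_le_iff₀ (by positivity)]
    nlinarith [lower k]
  have hnat : Tendsto (fun k : ℕ => (k : ℝ) ^ (1 / (k : ℝ))) atTop (𝓝 1) :=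
    tendsto_rpow_div.comp tendsto_natCast_atTop_atTop
  have hl := ((hconst (κ / 2) (by positivity)).div hnat one_ne_zero).mul_const M
  have hr := (hconst K hK).mul_const M
  rw [div_one, one_mul] at hl
  rw [one_mul] at hr
  refine tendsto_of_tendsto_of_tendsto_of_le_of_le' hl hr ?_ ?_
  · filter_upwards [eventually_gt_atTop 0] with k hk
    have hk' : (0 : ℝ) < k := by exact_mod_cast hk
    calc (κ / 2) ^ (1 / (k : ℝ)) / (k : ℝ) ^ (1 / (k : ℝ)) * M
        = (κ / 2 / k * M ^ k) ^ (1 / (k : ℝ)) := by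
          rw [Real.mul_rpow (by positivity) (by positivity), hpow k hk,
            Real.div_rpow (by positivity) hk'.le]
      _ ≤ _ := Real.rpow_le_rpow (by positivity) (hlow k hk) (by positivity)
  · filter_upwards [eventually_gt_atTop 0] with k hk
    calc u k ^ (1 / (k : ℝ)) ≤ (K * M ^ k) ^ (1 / (k : ℝ)) :=
          Real.rpow_le_rpow (le_trans (by positivity) (hlow k hk)) (upper k) (by positivity)
      _ = K ^ (1 / (k : ℝ)) * M := by
          rw [Real.mul_rpow (by positivity) (by positivity), hpow k hk]

/-- The word that has the letter `0` at the positions in `s` and the letter `1` elsewhere. -/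
def wordOfFinset {k : ℕ} (s : Finset (Fin k)) (j : Fin k) : Fin 2 := if j ∈ s then 0 else 1

theorem wordOfFinset_injective {k : ℕ} :
    Function.Injective (wordOfFinset : Finset (Fin k) → Fin k → Fin 2) := by
  intro s s' h
  ext j
  have := congrFun h j
  simp only [wordOfFinset] at this
  by_cases h1 : j ∈ s <;> by_cases h2 : j ∈ s' <;> simp_all

theorem choose_mul_le_sum {k m : ℕ} {f : (Fin k → Fin 2) → ℝ} (hf : ∀ w, 0 ≤ f w) {B : ℝ}
    (hB : ∀ s : Finset (Fin k), s.card = m → B ≤ f (wordOfFinset s)) :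
    (k.choose m : ℝ) * B ≤ ∑ w, f w := by
  classical
  calc (k.choose m : ℝ) * B
      = ∑ _s ∈ Finset.powersetCard m (Finset.univ : Finset (Fin k)), B := by simp
    _ ≤ ∑ s ∈ Finset.powersetCard m (Finset.univ : Finset (Fin k)), f (wordOfFinset s) :=
        Finset.sum_le_sum fun s hs => hB s (Finset.mem_powersetCard.1 hs).2
    _ = ∑ w ∈ (Finset.powersetCard m (Finset.univ : Finset (Fin k))).image wordOfFinset, f w :=
        (Finset.sum_image wordOfFinset_injective.injOn).symm
    _ ≤ ∑ w, f w := Finset.sum_le_univ_sum_of_nonneg hf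

theorem prod_wordOfFinset {k : ℕ} (s : Finset (Fin k)) (f : Fin 2 → ℝ) :
    ∏ j, f (wordOfFinset s j) = f 0 ^ s.card * f 1 ^ (k - s.card) := by
  have h : ∀ j, f (wordOfFinset s j) = if j ∈ s then f 0 else f 1 := by
    intro j
    by_cases hj : j ∈ s <;> simp [wordOfFinset, hj]
  simp_rw [h]
  rw [Finset.prod_ite, Finset.prod_const, Finset.prod_const, Finset.filter_mem_eq_inter,
    Finset.univ_inter, ← Finset.compl_filter, Finset.filter_mem_eq_inter,
    Finset.univ_inter, Finset.card_compl, Fintype.card_fin]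

/-- The summand of the pressure, in terms of the area and the eccentricity of a rectangle with side
lengths `x` and `y`. -/
theorem rpow_mul_rpow_sub {x y : ℝ} (hx : 0 < x) (hy : 0 < y) (τ t : ℝ) :
    x ^ τ * y ^ (t - τ) = (x * y) ^ (t / 2) * (x / y) ^ (τ - t / 2) := by
  rw [Real.mul_rpow hx.le hy.le, Real.div_rpow hx.le hy.le,
    div_eq_mul_inv (x ^ (τ - t / 2)), ← Real.rpow_neg hy.le, mul_mul_mul_comm, ← Real.rpow_add hx, ← Real.rpow_add hy]
  congr 2 <;> ring

theorem max_rpow_mul_min_rpow_le_add {x y : ℝ} (hx : 0 < x) (hy : 0 < y) (τ r : ℝ) :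
    max x y ^ τ * min x y ^ r ≤ x ^ τ * y ^ r + y ^ τ * x ^ r := by
  have h1 : 0 < x ^ τ * y ^ r := by positivity
  have h2 : 0 < y ^ τ * x ^ r := by positivity
  rcases le_total y x with h | h
  · rw [max_eq_left h, min_eq_right h]; linarith
  · rw [max_eq_right h, min_eq_left h]; linarith

theorem add_le_two_mul_max_rpow_mul_min_rpow {x y : ℝ} (hx : 0 < x) (hy : 0 < y) {τ r : ℝ}
    (hr : r ≤ τ) : x ^ τ * y ^ r + y ^ τ * x ^ r ≤ 2 * (max x y ^ τ * min x y ^ r) := by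
  have key : ∀ x y : ℝ, 0 < x → 0 < y → y ≤ x → y ^ τ * x ^ r ≤ x ^ τ * y ^ r := by
    intro x y hx hy hyx
    have h1 : ∀ z : ℝ, 0 < z → z ^ τ = z ^ (τ - r) * z ^ r := fun z hz => by
      rw [← Real.rpow_add hz, sub_add_cancel]
    have h2 : y ^ (τ - r) ≤ x ^ (τ - r) := Real.rpow_le_rpow hy.le hyx (by linarith)
    calc y ^ τ * x ^ r = y ^ (τ - r) * (x ^ r * y ^ r) := by rw [h1 y hy]; ring
      _ ≤ x ^ (τ - r) * (x ^ r * y ^ r) := by gcongr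
      _ = x ^ τ * y ^ r := by rw [h1 x hx]; ring
  rcases le_total y x with h | h
  · rw [max_eq_left h, min_eq_right h]; linarith [key x y hx hy h]
  · rw [max_eq_right h, min_eq_left h]; linarith [key y x hy hx h]

theorem max_rpow_mul_min_rpow_le_mul {x y : ℝ} (hx : 0 < x) (hy : 0 < y) {τ t : ℝ}
    (ht : 2 * τ ≤ t) : max x y ^ τ * min x y ^ (t - τ) ≤ (x * y) ^ (t / 2) := by
  have hmin : 0 < min x y := lt_min hx hy
  rw [rpow_mul_rpow_sub (lt_max_of_lt_left hx) hmin, max_mul_min]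
  refine mul_le_of_le_one_right (by positivity) (Real.rpow_le_one_of_one_le_of_nonpos ?_ ?_)
  · rw [one_le_div hmin]
    exact min_le_max
  · linarith

theorem mul_le_max_rpow_mul_min_rpow {x y ρ : ℝ} (hx : 0 < x) (hy : 0 < y) {τ t : ℝ}
    (ht : 2 * τ ≤ t) (hρ : max x y ≤ ρ * min x y) :
    (x * y) ^ (t / 2) * ρ ^ (τ - t / 2) ≤ max x y ^ τ * min x y ^ (t - τ) := by
  have hmin : 0 < min x y := lt_min hx hy
  have hmax : 0 < max x y := lt_max_of_lt_left hx
  rw [rpow_mul_rpow_sub hmax hmin, max_mul_min]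
  refine mul_le_mul_of_nonneg_left ?_ (by positivity)
  refine Real.rpow_le_rpow_of_nonpos (by positivity) ?_ (by linarith)
  rwa [div_le_iff₀ hmin]

namespace DiagonalSystem

variable {ι : Type*} [Fintype ι] (D : DiagonalSystem ι)

theorem c_pos (i : ι) : 0 < D.c i := D.abs_a_pos i

theorem d_pos (i : ι) : 0 < D.d i := D.abs_b_pos i

theorem cWord_pos {k : ℕ} (w : Fin k → ι) : 0 < D.cWord w :=
  Finset.prod_pos fun _ _ => D.c_pos _

theorem dWord_pos {k : ℕ} (w : Fin k → ι) : 0 < D.dWord w :=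
  Finset.prod_pos fun _ _ => D.d_pos _

theorem sum_cWord_rpow_mul_dWord_rpow (k : ℕ) (s r : ℝ) :
    ∑ w : Fin k → ι, D.cWord w ^ s * D.dWord w ^ r = (∑ i, D.c i ^ s * D.d i ^ r) ^ k := by
  rw [Fintype.sum_pow]
  refine Finset.sum_congr rfl fun w _ => ?_
  rw [cWord, dWord, ← Real.finsetProd_rpow _ _ fun i _ => (D.c_pos _).le,
    ← Real.finsetProd_rpow _ _ fun i _ => (D.d_pos _).le, Finset.prod_mul_distrib]

end DiagonalSystem

section TwoMapSystem

variable {c d : ℝ} (hd : 0 < d) (hdc : d < c) (hcd : c + d ≤ 1)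

theorem twoMapSystem_c_zero : (twoMapSystem c d hd hdc hcd).c 0 = c :=
  abs_of_pos (hd.trans hdc)

theorem twoMapSystem_c_one : (twoMapSystem c d hd hdc hcd).c 1 = d :=
  abs_of_pos hd

theorem twoMapSystem_d_zero : (twoMapSystem c d hd hdc hcd).d 0 = d :=
  abs_of_pos hd

theorem twoMapSystem_d_one : (twoMapSystem c d hd hdc hcd).d 1 = c :=
  abs_of_pos (hd.trans hdc)

theorem twoMapSystem_cWord_mul_dWord {k : ℕ} (w : Fin k → Fin 2) :
    (twoMapSystem c d hd hdc hcd).cWord w * (twoMapSystem c d hd hdc hcd).dWord w =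
      (c * d) ^ k := by
  rw [DiagonalSystem.cWord, DiagonalSystem.dWord, ← Finset.prod_mul_distrib]
  have : ∀ i : Fin 2, (twoMapSystem c d hd hdc hcd).c i * (twoMapSystem c d hd hdc hcd).d i =
      c * d := by
    intro i
    fin_cases i
    · exact congrArg₂ _ (twoMapSystem_c_zero hd hdc hcd) (twoMapSystem_d_zero hd hdc hcd)
    · exact (congrArg₂ _ (twoMapSystem_c_one hd hdc hcd) (twoMapSystem_d_one hd hdc hcd)).trans
        (mul_comm d c)
  simp [this]

theorem twoMapSystem_Psi {μ : Measure (ℝ × ℝ)} {q τ : ℝ}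
    (h1 : lqSpectrum (μ.map Prod.fst) q = τ) (h2 : lqSpectrum (μ.map Prod.snd) q = τ)
    (t : ℝ) (k : ℕ) :
    (twoMapSystem c d hd hdc hcd).Psi μ t q k = ((1 / 2) ^ q) ^ k *
      ∑ w : Fin k → Fin 2, (twoMapSystem c d hd hdc hcd).alpha1 w ^ τ *
        (twoMapSystem c d hd hdc hcd).alpha2 w ^ (t - τ) := by
  rw [DiagonalSystem.Psi, Finset.mul_sum]
  refine Finset.sum_congr rfl fun w _ => ?_
  have hp : (twoMapSystem c d hd hdc hcd).pWord w = (1 / 2) ^ k := by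
    simp [DiagonalSystem.pWord, twoMapSystem]
  rw [DiagonalSystem.psi, DiagonalSystem.tauWord, h1, h2, ite_self, hp,
    ← Real.rpow_pow_comm (by norm_num), mul_assoc]

/-- For `t ≤ 2 τ` the summands are, up to a factor two, sums of two multiplicative functions of
the word. -/
theorem twoMapSystem_hasPressure_of_le {μ : Measure (ℝ × ℝ)} {q τ : ℝ}
    (h1 : lqSpectrum (μ.map Prod.fst) q = τ) (h2 : lqSpectrum (μ.map Prod.snd) q = τ)
    {t : ℝ} (ht : t ≤ 2 * τ) :
    (twoMapSystem c d hd hdc hcd).HasPressure μ t q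
      ((1 / 2) ^ q * (c ^ τ * d ^ (t - τ) + d ^ τ * c ^ (t - τ))) := by
  have hc : 0 < c := hd.trans hdc
  set D := twoMapSystem c d hd hdc hcd with hD
  have e1 : ∀ k, ∑ w : Fin k → Fin 2, D.cWord w ^ τ * D.dWord w ^ (t - τ) =
      (c ^ τ * d ^ (t - τ) + d ^ τ * c ^ (t - τ)) ^ k := by
    intro k
    rw [D.sum_cWord_rpow_mul_dWord_rpow, Fin.sum_univ_two, hD, twoMapSystem_c_zero,
      twoMapSystem_c_one, twoMapSystem_d_zero, twoMapSystem_d_one]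
  have e2 : ∀ k, ∑ w : Fin k → Fin 2, D.dWord w ^ τ * D.cWord w ^ (t - τ) =
      (c ^ τ * d ^ (t - τ) + d ^ τ * c ^ (t - τ)) ^ k := by
    intro k
    simp_rw [mul_comm (D.dWord _ ^ τ)]
    rw [D.sum_cWord_rpow_mul_dWord_rpow, Fin.sum_univ_two, hD, twoMapSystem_c_zero,
      twoMapSystem_c_one, twoMapSystem_d_zero, twoMapSystem_d_one]
    ring
  refine tendsto_rpow_one_div_of_bounds (κ := 1) (K := 2) one_pos two_pos (by positivity)
    (fun k => ?_) (fun k => ?_)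
  · rw [hD, twoMapSystem_Psi hd hdc hcd h1 h2, ← hD, mul_pow]
    have h : 2 * (c ^ τ * d ^ (t - τ) + d ^ τ * c ^ (t - τ)) ^ k ≤
        2 * ∑ w : Fin k → Fin 2, D.alpha1 w ^ τ * D.alpha2 w ^ (t - τ) := by
      rw [two_mul, Finset.mul_sum]
      nth_rewrite 1 [← e1]
      rw [← e2, ← Finset.sum_add_distrib]
      exact Finset.sum_le_sum fun w _ => add_le_two_mul_max_rpow_mul_min_rpow (D.cWord_pos w)
        (D.dWord_pos w) (by linarith)
    have hk : (1 : ℝ) ≤ k + 1 := by linarith [k.cast_nonneg (α := ℝ)]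
    refine mul_le_mul hk (mul_le_mul_of_nonneg_left (by linarith) (by positivity)) (by positivity)
      (by positivity)
  · rw [hD, twoMapSystem_Psi hd hdc hcd h1 h2, ← hD, mul_pow, mul_left_comm]
    refine mul_le_mul_of_nonneg_left ?_ (by positivity)
    rw [two_mul]
    nth_rewrite 1 [← e1]
    rw [← e2, ← Finset.sum_add_distrib]
    exact Finset.sum_le_sum fun w _ => max_rpow_mul_min_rpow_le_add (D.cWord_pos w)
      (D.dWord_pos w) _ _

/-- For `t ≥ 2 τ` the sum is dominated by the words in which both letters occur equally often, whose
images are almost square. -/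
theorem twoMapSystem_hasPressure_of_ge {μ : Measure (ℝ × ℝ)} {q τ : ℝ}
    (h1 : lqSpectrum (μ.map Prod.fst) q = τ) (h2 : lqSpectrum (μ.map Prod.snd) q = τ)
    {t : ℝ} (ht : 2 * τ ≤ t) :
    (twoMapSystem c d hd hdc hcd).HasPressure μ t q ((1 / 2) ^ q * (2 * (c * d) ^ (t / 2))) := by
  have hc : 0 < c := hd.trans hdc
  set D := twoMapSystem c d hd hdc hcd with hD
  have hcdk : ∀ k : ℕ, ((c * d) ^ k) ^ (t / 2) = ((c * d) ^ (t / 2)) ^ k := by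
    intro k
    rw [Real.rpow_pow_comm (by positivity)]
  refine tendsto_rpow_one_div_of_bounds (κ := (c / d) ^ (τ - t / 2)) (K := 1) (by positivity)
    one_pos (by positivity) (fun k => ?_) (fun k => ?_)
  · rw [hD, twoMapSystem_Psi hd hdc hcd h1 h2, ← hD]
    have hsum : (k.choose (k / 2) : ℝ) *
        (((c * d) ^ k) ^ (t / 2) * (c / d) ^ (τ - t / 2)) ≤
        ∑ w : Fin k → Fin 2, D.alpha1 w ^ τ * D.alpha2 w ^ (t - τ) := by
      refine choose_mul_le_sum (fun w => ?_) fun s hs => ?_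
      · have := D.cWord_pos w
        have := D.dWord_pos w
        exact mul_nonneg (Real.rpow_nonneg (le_max_of_le_left (by positivity)) _)
          (Real.rpow_nonneg (le_min (by positivity) (by positivity)) _)
      · rw [← twoMapSystem_cWord_mul_dWord hd hdc hcd (wordOfFinset s), ← hD]
        refine mul_le_max_rpow_mul_min_rpow (D.cWord_pos _) (D.dWord_pos _) ht ?_
        have hC : D.cWord (wordOfFinset s) = c ^ (k / 2) * d ^ (k - k / 2) := by
          rw [DiagonalSystem.cWord, prod_wordOfFinset, hs, hD, twoMapSystem_c_zero,
            twoMapSystem_c_one]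
        have hD' : D.dWord (wordOfFinset s) = d ^ (k / 2) * c ^ (k - k / 2) := by
          rw [DiagonalSystem.dWord, prod_wordOfFinset, hs, hD, twoMapSystem_d_zero,
            twoMapSystem_d_one]
        have hcd1 : 1 ≤ c / d := by rw [one_le_div hd]; exact hdc.le
        -- the two side lengths agree for even `k` and differ by the factor `c / d` for odd `k`
        rcases Nat.even_or_odd' k with ⟨m, hm | hm⟩
        · have e1 : k / 2 = m := by omega
          have e2 : k - k / 2 = m := by omega
          rw [hC, hD', e2, e1, mul_comm (d ^ m), max_self, min_self]
          exact le_mul_of_one_le_left (by positivity) hcd1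
        · have e1 : k / 2 = m := by omega
          have e2 : k - k / 2 = m + 1 := by omega
          have hle : c ^ m * d ^ (m + 1) ≤ d ^ m * c ^ (m + 1) := by
            calc c ^ m * d ^ (m + 1) = (c ^ m * d ^ m) * d := by ring
              _ ≤ (c ^ m * d ^ m) * c := by gcongr
              _ = _ := by ring
          rw [hC, hD', e2, e1, max_eq_right hle, min_eq_left hle]
          refine le_of_eq ?_
          field_simp
          ring
    have hch : (2 : ℝ) ^ k ≤ (k + 1) * k.choose (k / 2) := by
      have : 2 ^ k ≤ (k + 1) * k.choose (k / 2) := by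
        rw [← Nat.sum_range_choose]
        refine (Finset.sum_le_card_nsmul _ _ _ fun i _ => Nat.choose_le_middle i k).trans_eq ?_
        simp
      exact_mod_cast this
    calc (c / d) ^ (τ - t / 2) * ((1 / 2) ^ q * (2 * (c * d) ^ (t / 2))) ^ k
        = ((1 / 2) ^ q) ^ k *
          (2 ^ k * (((c * d) ^ k) ^ (t / 2) * (c / d) ^ (τ - t / 2))) := by
          rw [hcdk, mul_pow, mul_pow]; ring
      _ ≤ ((1 / 2) ^ q) ^ k * ((k + 1) * k.choose (k / 2) *
          (((c * d) ^ k) ^ (t / 2) * (c / d) ^ (τ - t / 2))) := by gcongr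
      _ = ((1 / 2) ^ q) ^ k * ((k + 1) * (k.choose (k / 2) *
          (((c * d) ^ k) ^ (t / 2) * (c / d) ^ (τ - t / 2)))) := by ring
      _ ≤ ((1 / 2) ^ q) ^ k * ((k + 1) * ∑ w : Fin k → Fin 2,
          D.alpha1 w ^ τ * D.alpha2 w ^ (t - τ)) := by gcongr
      _ = _ := by ring
  · rw [hD, twoMapSystem_Psi hd hdc hcd h1 h2, ← hD, one_mul, mul_pow, mul_pow, ← hcdk]
    refine mul_le_mul_of_nonneg_left ?_ (by positivity)
    refine (Finset.sum_le_card_nsmul _ _ (((c * d) ^ k) ^ (t / 2)) fun w _ => ?_).trans_eq ?_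
    · rw [← twoMapSystem_cWord_mul_dWord hd hdc hcd w]
      exact max_rpow_mul_min_rpow_le_mul (D.cWord_pos w) (D.dWord_pos w) ht
    · simp

/-! ### The projections of the planar measure -/

theorem twoMapSystem_isTwoMapMeasure_fst {μ : Measure (ℝ × ℝ)}
    (hμ : (twoMapSystem c d hd hdc hcd).IsSelfAffineMeasure μ) :
    IsTwoMapMeasure c d (μ.map Prod.fst) := by
  obtain ⟨hprob, hinv⟩ := hμ
  refine ⟨Measure.isProbabilityMeasure_map measurable_fst.aemeasurable, ?_⟩
  have hhalf : ENNReal.ofReal (1 / 2) = 1 / 2 := by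
    rw [ENNReal.ofReal_div_of_pos (by norm_num)]; simp
  have hS : ∀ i, Measurable ((twoMapSystem c d hd hdc hcd).S i) := fun i => by
    unfold DiagonalSystem.S; fun_prop
  conv_lhs => rw [hinv]
  rw [Fin.sum_univ_two, Measure.map_add _ _ measurable_fst, Measure.map_smul, Measure.map_smul,
    Measure.map_map measurable_fst (hS _), Measure.map_map measurable_fst (hS _),
    Measure.map_map (by fun_prop) measurable_fst, Measure.map_map (by fun_prop) measurable_fst]
  change ENNReal.ofReal (1 / 2) • _ + ENNReal.ofReal (1 / 2) • _ = _
  rw [hhalf]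
  congr 3
  funext z
  simp [DiagonalSystem.S, twoMapSystem]

theorem twoMapSystem_isTwoMapMeasure_snd {μ : Measure (ℝ × ℝ)}
    (hμ : (twoMapSystem c d hd hdc hcd).IsSelfAffineMeasure μ) :
    IsTwoMapMeasure d c (μ.map Prod.snd) := by
  obtain ⟨hprob, hinv⟩ := hμ
  refine ⟨Measure.isProbabilityMeasure_map measurable_snd.aemeasurable, ?_⟩
  have hhalf : ENNReal.ofReal (1 / 2) = 1 / 2 := by
    rw [ENNReal.ofReal_div_of_pos (by norm_num)]; simp
  have hS : ∀ i, Measurable ((twoMapSystem c d hd hdc hcd).S i) := fun i => by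
    unfold DiagonalSystem.S; fun_prop
  conv_lhs => rw [hinv]
  rw [Fin.sum_univ_two, Measure.map_add _ _ measurable_snd, Measure.map_smul, Measure.map_smul,
    Measure.map_map measurable_snd (hS _), Measure.map_map measurable_snd (hS _),
    Measure.map_map (by fun_prop) measurable_snd, Measure.map_map (by fun_prop) measurable_snd]
  change ENNReal.ofReal (1 / 2) • _ + ENNReal.ofReal (1 / 2) • _ = _
  rw [hhalf]
  congr 3
  funext z
  simp [DiagonalSystem.S, twoMapSystem]

end TwoMapSystem

/-! ### The scaling exponents -/

theorem exists_neg_root {c d q : ℝ} (hc : 0 < c) (hc1 : c < 1) (hd : 0 < d) (hq : 1 < q) :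
    ∃ τ : ℝ, τ < 0 ∧ (1 / 2) ^ q * (c ^ τ + d ^ τ) = 1 := by
  have hcont : Continuous fun x : ℝ => (1 / 2 : ℝ) ^ q * (c ^ x + d ^ x) :=
    continuous_const.mul ((Real.continuous_const_rpow hc.ne').add
      (Real.continuous_const_rpow hd.ne'))
  have h0 : (1 / 2 : ℝ) ^ q * (c ^ (0 : ℝ) + d ^ (0 : ℝ)) < 1 := by
    have := Real.rpow_lt_rpow_of_exponent_gt (x := 1 / 2) (by norm_num) (by norm_num) hq
    rw [Real.rpow_one] at this
    rw [Real.rpow_zero, Real.rpow_zero]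
    linarith
  have hpow : (1 / 2 : ℝ) ^ q * 2 ^ q = 1 := by
    rw [← Real.mul_rpow (by norm_num) (by norm_num)]
    norm_num
  set x := Real.logb c (2 ^ q)
  have hx : c ^ x = 2 ^ q := Real.rpow_logb hc hc1.ne (by positivity)
  have hx0 : x ≤ 0 := (Real.logb_neg_of_base_lt_one hc hc1
    (Real.one_lt_rpow (by norm_num) (by linarith))).le
  have h1 : 1 ≤ (1 / 2 : ℝ) ^ q * (c ^ x + d ^ x) := by
    rw [mul_add, hx, hpow]
    linarith [show 0 < (1 / 2 : ℝ) ^ q * d ^ x by positivity]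
  obtain ⟨τ, hτ, hτ1⟩ := intermediate_value_Icc' hx0 hcont.continuousOn ⟨h0.le, h1⟩
  refine ⟨τ, lt_of_le_of_ne hτ.2 ?_, hτ1⟩
  rintro rfl
  exact h0.ne hτ1

theorem theorem3p4 (c d : ℝ) (hd : 0 < d) (hdc : d < c) (hcd : c + d ≤ 1)
    (D : DiagonalSystem (Fin 2)) (hD : D = twoMapSystem c d hd hdc hcd)
    (μ : Measure (ℝ × ℝ)) (hμ : D.IsSelfAffineMeasure μ)
    (q : ℝ) (hq : 1 < q) :
    -- the spectra of the two projections exist, and so does the limit `P(t, q)` for every `t`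
    HasLqSpectrum (μ.map Prod.fst) q (lqSpectrum (μ.map Prod.fst) q) ∧
    HasLqSpectrum (μ.map Prod.snd) q (lqSpectrum (μ.map Prod.snd) q) ∧
    (∀ t : ℝ, ∃ P : ℝ, D.HasPressure μ t q P) ∧
    -- `γ(q)`, `γ_A(q)` and `γ_B(q)` are well defined by their equations
    ∃ γ γA γB : ℝ,
      (∀ t : ℝ, D.IsGamma μ q t ↔ t = γ) ∧
      (∀ t : ℝ, D.IsGammaA μ q t ↔ t = γA) ∧
      (∀ t : ℝ, D.IsGammaB μ q t ↔ t = γB) ∧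
      -- the strict inequality and its quantitative form
      γ < min γA γB ∧
      γA = γB ∧
      γA < 0 ∧
      γ ≤ γA - 2 * Real.log (2 * (d / c) ^ (γA / 2) / ((d / c) ^ γA + 1)) / Real.log (c * d) ∧
      -- the case that Fraser's question asks about: `min {γ_A, γ_B} ≥ τ₁ + τ₂`, and neither of
      -- the two logarithmic sums is nonnegative
      lqSpectrum (μ.map Prod.fst) q + lqSpectrum (μ.map Prod.snd) q ≤ min γA γB ∧
      ∑ i, D.p i ^ q * D.c i ^ lqSpectrum (μ.map Prod.fst) q *
        D.d i ^ (γA - lqSpectrum (μ.map Prod.fst) q) * Real.log (D.c i / D.d i) < 0 ∧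
      ∑ i, D.p i ^ q * D.d i ^ lqSpectrum (μ.map Prod.snd) q *
        D.c i ^ (γB - lqSpectrum (μ.map Prod.snd) q) * Real.log (D.d i / D.c i) < 0 := by
  subst hD
  have hc : 0 < c := hd.trans hdc
  have hc1 : c < 1 := by linarith
  have hd1 : d < 1 := by linarith
  obtain ⟨τ, hτ, heq⟩ := exists_neg_root hc hc1 hd hq
  have heq' : (1 / 2) ^ q * (d ^ τ + c ^ τ) = 1 := by rw [add_comm]; exact heq
  have s1 := (twoMapSystem_isTwoMapMeasure_fst hd hdc hcd hμ).hasLqSpectrum hc hc1 hd hd1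
    hcd hq hτ heq
  have s2 := (twoMapSystem_isTwoMapMeasure_snd hd hdc hcd hμ).hasLqSpectrum hd hd1 hc hc1
    (by linarith) hq hτ heq'
  have l1 : lqSpectrum (μ.map Prod.fst) q = τ := by rw [lqSpectrum, s1.1, EReal.toReal_coe]
  have l2 : lqSpectrum (μ.map Prod.snd) q = τ := by rw [lqSpectrum, s2.1, EReal.toReal_coe]
  have hle := fun t ht => twoMapSystem_hasPressure_of_le hd hdc hcd l1 l2 (t := t) ht
  have hge := fun t ht => twoMapSystem_hasPressure_of_ge hd hdc hcd l1 l2 (t := t) ht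
  have hp : ∀ i, (twoMapSystem c d hd hdc hcd).p i = 1 / 2 := fun _ => rfl
  simp only [DiagonalSystem.IsGammaA, DiagonalSystem.IsGammaB, Fin.sum_univ_two, hp,
    twoMapSystem_c_zero, twoMapSystem_c_one, twoMapSystem_d_zero, twoMapSystem_d_one, l1, l2]
  have hw : 0 < (1 / 2 : ℝ) ^ q := by positivity
  have hwq : (1 / 2 : ℝ) ^ q * (2 * 2 ^ (q - 1)) = 1 := by
    rw [mul_comm 2, ← Real.rpow_add_one (by norm_num), sub_add_cancel,
      ← Real.mul_rpow (by norm_num) (by norm_num)]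
    norm_num
  have hsum : c ^ τ + d ^ τ = 2 * 2 ^ (q - 1) :=
    mul_left_cancel₀ hw.ne' (heq.trans hwq.symm)
  have hx1 : 1 < c ^ τ := Real.one_lt_rpow_of_pos_of_lt_one_of_neg hc hc1 hτ
  have hy1 : 1 < d ^ τ := Real.one_lt_rpow_of_pos_of_lt_one_of_neg hd hd1 hτ
  have hxy : c ^ τ < d ^ τ := Real.rpow_lt_rpow_of_neg hd hdc hτ
  have hcd0 : 0 < c * d := mul_pos hc hd
  have hcd1 : c * d < 1 := by nlinarith
  -- `γ / 2` is the exponent with `(c d) ^ (γ / 2) = 2 ^ (q - 1)`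
  obtain ⟨γ, hγ⟩ : ∃ γ : ℝ, (c * d) ^ (γ / 2) = 2 ^ (q - 1) :=
    ⟨2 * Real.logb (c * d) (2 ^ (q - 1)), by
      rw [mul_div_cancel_left₀ _ two_ne_zero]
      exact Real.rpow_logb hcd0 hcd1.ne (by positivity)⟩
  have hγτ2 : 2 * τ < γ := by
    have : (c * d) ^ (γ / 2) < (c * d) ^ τ := by
      rw [hγ, Real.mul_rpow hc.le hd.le]
      nlinarith
    have := (Real.rpow_lt_rpow_left_iff_of_base_lt_one hcd0 hcd1).1 this
    linarith
  have hanti : StrictAnti fun t : ℝ =>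
      (1 / 2 : ℝ) ^ q * (c ^ τ * d ^ (t - τ) + d ^ τ * c ^ (t - τ)) := by
    intro t t' htt
    have h1 := Real.rpow_lt_rpow_of_exponent_gt hc hc1 (sub_lt_sub_right htt τ)
    have h2 := Real.rpow_lt_rpow_of_exponent_gt hd hd1 (sub_lt_sub_right htt τ)
    dsimp only
    gcongr
  have hτ1 : (1 / 2 : ℝ) ^ q * (c ^ τ * d ^ (τ - τ) + d ^ τ * c ^ (τ - τ)) = 1 := by
    rw [sub_self, Real.rpow_zero, Real.rpow_zero, mul_one, mul_one, heq]
  have hX : ∀ z : ℝ, 0 < z → z ^ τ = z ^ (τ / 2) * z ^ (τ / 2) := fun z hz => by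
    rw [← Real.rpow_add hz, add_halves]
  have hX0 : 0 < c ^ (τ / 2) := by positivity
  have hY0 : 0 < d ^ (τ / 2) := by positivity
  have hγτ : γ < τ := by
    have hXY : c ^ (τ / 2) < d ^ (τ / 2) := Real.rpow_lt_rpow_of_neg hd hdc (by linarith)
    have : (c * d) ^ (τ / 2) < (c * d) ^ (γ / 2) := by
      rw [hγ, Real.mul_rpow hc.le hd.le]
      rw [hX c hc, hX d hd] at hsum
      nlinarith [sq_pos_of_pos (sub_pos.2 hXY)]
    have := (Real.rpow_lt_rpow_left_iff_of_base_lt_one hcd0 hcd1).1 this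
    linarith
  have hlog : 0 < Real.log (c / d) := Real.log_pos (by rwa [one_lt_div hd])
  have hlog' : Real.log (d / c) = -Real.log (c / d) := by rw [← Real.log_inv, inv_div]
  refine ⟨s1, s2, fun t => ?_, γ, τ, τ, fun t => ?_, fun t => ?_, fun t => ?_, by rwa [min_self],
    rfl, hτ, le_of_eq ?_, ?_, ?_, ?_⟩
  · rcases le_total t (2 * τ) with ht | ht
    · exact ⟨_, hle t ht⟩
    · exact ⟨_, hge t ht⟩
  · constructor
    · intro ht
      rcases le_total t (2 * τ) with h | h
      · exfalso
        have h1 := tendsto_nhds_unique ht (hle t h)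
        have h2 := hanti.antitone h
        have h3 : c ^ τ + d ^ τ < c ^ τ * d ^ τ + d ^ τ * c ^ τ := by nlinarith
        have h4 := mul_lt_mul_of_pos_left h3 hw
        simp only [two_mul, add_sub_cancel_right] at h2
        linarith
      · have h1 := tendsto_nhds_unique ht (hge t h)
        have h2 : (c * d) ^ (t / 2) = (c * d) ^ (γ / 2) := by
          rw [hγ]
          have h3 := mul_left_cancel₀ hw.ne' (h1.symm.trans hwq.symm)
          linarith
        have := (Real.strictAnti_rpow_of_base_lt_one hcd0 hcd1).injective h2
        linarith
    · rintro rfl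
      have := hge t hγτ2.le
      rwa [hγ, hwq] at this
  · rw [mul_assoc, mul_assoc, ← mul_add]
    constructor
    · exact fun h => hanti.injective (h.trans hτ1.symm)
    · rintro rfl; exact hτ1
  · rw [mul_assoc, mul_assoc, ← mul_add, add_comm]
    constructor
    · exact fun h => hanti.injective (h.trans hτ1.symm)
    · rintro rfl; exact hτ1
  · have hquot : 2 * (d / c) ^ (τ / 2) / ((d / c) ^ τ + 1) = (c * d) ^ ((τ - γ) / 2) := by
      rw [sub_div, Real.rpow_sub hcd0, hγ, Real.mul_rpow hc.le hd.le,
        Real.div_rpow hd.le hc.le, Real.div_rpow hd.le hc.le,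
        show (2 : ℝ) ^ (q - 1) = (c ^ τ + d ^ τ) / 2 by linarith, hX c hc, hX d hd]
      field_simp
      ring
    have := (Real.log_neg hcd0 hcd1).ne
    rw [hquot, Real.log_rpow hcd0]
    field_simp
    ring
  · rw [min_self]; linarith
  · rw [hlog', sub_self, Real.rpow_zero, Real.rpow_zero]
    nlinarith [mul_pos (mul_pos hw hlog) (sub_pos.2 hxy)]
  · rw [hlog', sub_self, Real.rpow_zero, Real.rpow_zero]
    nlinarith [mul_pos (mul_pos hw hlog) (sub_pos.2 hxy)]
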